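/- Let $G$ be a topological group. Let $T_G$ be the site whose underlying category is the category of $G$-spaces (topological spaces with a continuous action of $G$) and continuous $G$-equivariant maps, in which a family $\{\pi_i : X_i \to X\}$ is a covering if and only if every $x \in X$ has an open neighbourhood $V$ such that, for some $i$, there is a continuous (not necessarily equivariant) map $s : V \to X_i$ with $\pi_i \circ s$ the inclusion of $V$ in $X$. Let $*$ be the one-point $G$-space. For an abelian sheaf $F$ on $T_G$, let $H^n(T_G, *, F)$ be its sheaf cohomology at $*$, and for $p \ge 0$ let $F_p$ be the sheaf on the topological space $G^p$ given by $F_p(U) = F(G \times U)$, where $G$ acts by left translation on $G$ and trivially on $U$. For a sheaf $P$ on a space $X$ let $C^0(P)$ be the sheaf $U \mapsto \prod_{x \in U} P_x$, and let $$0 \to P \to C^0(P) \to C^0(C^0(P)) \to \cdots$$ be the second canonical flabby resolution (Godement), whose differential from the $(q+1)$-fold to the $(q+2)$-fold iterate of $C^0$ is $\sum_{i=0}^{q+1} (-1)^i d_i$, where $d_i$ is obtained by applying $C^0$ exactly $i$ times to the canonical embedding of the $(q+1-i)$-fold iterate in the $(q+2-i)$-fold one. Let $T_{q,p}$ be its degree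 $q$ term for $P = F_p$ on $G^p$. For $0 \le i \le p+1$ the $G$-maps $G \times G^{p+1} \to G \times G^{p}$, $$(g_0, \dots, g_{p+1}) \mapsto (g_0, \dots, g_i g_{i+1}, \dots, g_{p+1}) \ (0 \le i \le p), \qquad (g_0, \dots, g_{p+1}) \mapsto (g_0, \dots, g_{p}) \ (i = p+1),$$ cover maps $\bar\rho_i : G^{p+1} \to G^p$ and induce morphisms $F_p \to (\bar\rho_i)_* F_{p+1}$, hence maps $\Gamma(G^p, T_{q,p}) \to \Gamma(G^{p+1}, T_{q,p+1})$; their alternating sums over $i$ make $K^{p,q}(F) = \Gamma(G^p, T_{q,p})$ into a double complex. Let $\tilde H^n(G, F)$ be the cohomology in degree $n$ of its total complex. Then: 1. For every $n \ge 0$ there is an isomorphism $H^n(T_G, *, F) \cong \tilde H^n(G, F)$, functorial in $F$. 2. For all $p, q \ge 0$ there is an isomorphism, functorial in $F$, between the sheaf cohomology $H^q_{top}(G^p, F_p)$ of the topological space $G^p$ and the cohomology $H^q(K^{p,\bullet}(F))$ of the $p$-th column; and for every $F$ there is a first quadrant spectral sequence $$E_1^{p,q} = H^q_{top}(G^p,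 F_p) \Rightarrow H^{p+q}(T_G, *, F)$$ in which, under these isomorphisms, $d_1^{p,q}$ is the map $H^q(K^{p,\bullet}(F)) \to H^q(K^{p+1,\bullet}(F))$ induced by the horizontal differential. Here convergence means that each $H^n(T_G,*,F)$ has a decreasing filtration $\mathrm{Fil}^0 = H^n \supseteq \mathrm{Fil}^1 \supseteq \cdots \supseteq \mathrm{Fil}^{n+1} = 0$ with $\mathrm{Fil}^p H^{p+q} / \mathrm{Fil}^{p+1} H^{p+q} \cong E_r^{p,q}$ for all $r > \max(p, q+1)$. -/

import Mathlib

open CategoryTheory Limits Opposite TopologicalSpace AlgebraicGeometry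

universe u v w

noncomputable section

set_option linter.unusedSectionVars false
set_option linter.unusedVariables false

namespace LocalSection

/-! ### The category of `G`-spaces and the local-section topology -/

/-- A `G`-space: a topological space with a continuous action of `G`. -/
structure GSpace (G : Type u) [Group G] [TopologicalSpace G] : Type (u + 1) where
  carrier : Type u
  [top : TopologicalSpace carrier]
  [act : MulAction G carrier]
  [cont : ContinuousSMul G carrier]

attribute [instance] GSpace.top GSpace.act GSpace.cont

variable {G : Type u} [Group G] [TopologicalSpace G]

instance : CoeSort (GSpace G) (Type u) := ⟨GSpace.carrier⟩

/-- A `G`-morphism: a continuous equivariant map. -/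
@[ext]
structure GSpace.Hom (X Y : GSpace G) : Type u where
  toFun : X → Y
  continuous_toFun : Continuous toFun
  map_smul' : ∀ (g : G) (x : X), toFun (g • x) = g • toFun x

instance : Category (GSpace G) where
  Hom := GSpace.Hom
  id X := ⟨id, continuous_id, fun _ _ => rfl⟩
  comp f g := ⟨g.toFun ∘ f.toFun, g.continuous_toFun.comp f.continuous_toFun,
    fun a x => by simp [f.map_smul', g.map_smul']⟩

/-- The underlying map of a `G`-morphism. -/
abbrev GSpace.fn {X Y : GSpace G} (f : X ⟶ Y) : X → Y := GSpace.Hom.toFun f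

lemma GSpace.continuous_fn {X Y : GSpace G} (f : X ⟶ Y) : Continuous (GSpace.fn f) :=
  GSpace.Hom.continuous_toFun f

lemma GSpace.fn_smul {X Y : GSpace G} (f : X ⟶ Y) (g : G) (x : X) :
    GSpace.fn f (g • x) = g • GSpace.fn f x :=
  GSpace.Hom.map_smul' f g x

lemma GSpace.hom_ext {X Y : GSpace G} {f g : X ⟶ Y} (h : ∀ x, GSpace.fn f x = GSpace.fn g x) :
    f = g :=
  GSpace.Hom.ext (funext h)

section Free

variable [IsTopologicalGroup G] {T T' : Type u} [TopologicalSpace T] [TopologicalSpace T']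

variable (G T) in
/-- The `G`-space `G × T`, with `G` acting by left translation on the first factor and trivially
on the second one. -/
def free : GSpace G where
  carrier := G × T
  act :=
    { smul (g : G) (p : G × T) := (g * p.1, p.2)
      one_smul p := Prod.ext (one_mul p.1) rfl
      mul_smul g h p := Prod.ext (mul_assoc g h p.1) rfl }
  cont :=
    letI : SMul G (G × T) := ⟨fun g p => (g * p.1, p.2)⟩
    ⟨by
      change Continuous fun p : G × (G × T) => (p.1 * p.2.1, p.2.2)
      fun_prop⟩

/-- The `G`-map `G × T' ⟶ G × T`, `(g, t) ↦ (g * c t, f t)`, attached to continuous maps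
`f : T' → T` and `c : T' → G`. -/
def freeMap (f : C(T', T)) (c : C(T', G)) : free G T' ⟶ free G T where
  toFun (p : G × T') := (p.1 * c p.2, f p.2)
  continuous_toFun := by
    change Continuous fun p : G × T' => (p.1 * c p.2, f p.2)
    fun_prop
  map_smul' g p := Prod.ext (mul_assoc g p.1 _) rfl

/-- The `G`-map `G × T ⟶ X`, `(g, t) ↦ g • s t`, attached to a continuous map `s : T → X`. -/
def freeDesc {X : GSpace G} (s : C(T, X)) : free G T ⟶ X where
  toFun (p : G × T) := p.1 • s p.2
  continuous_toFun := by
    change Continuous fun p : G × T => p.1 • s p.2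
    fun_prop
  map_smul' g p := mul_smul g p.1 _

end Free

/-- A sieve on `X` *admits local sections* if every point of `X` has an open neighbourhood `V`
with a continuous (not necessarily equivariant) map `s : V → Y` such that `f ∘ s` is the inclusion
of `V`, for some `f : Y ⟶ X` in the sieve. -/
def HasLocalSections {X : GSpace G} (S : Sieve X) : Prop :=
  ∀ x : X, ∃ V : Opens X, x ∈ V ∧ ∃ (Y : GSpace G) (f : Y ⟶ X), S f ∧
    ∃ s : C(V, Y), ∀ v : V, GSpace.fn f (s v) = v

variable (G) in
/-- The local-section topology `T_G` on the category of `G`-spaces: a family of `G`-maps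
is covering iff the sieve it generates admits local sections. -/
def topology [IsTopologicalGroup G] : GrothendieckTopology (GSpace G) where
  sieves X := {S | HasLocalSections S}
  top_mem' X x := ⟨⊤, trivial, X, 𝟙 X, trivial, ⟨Subtype.val, continuous_subtype_val⟩,
    fun _ => rfl⟩
  pullback_stable' := by
    intro X Z S g hS z
    obtain ⟨V, hV, Y, f, hf, s, hs⟩ := hS (GSpace.fn g z)
    let W : Opens Z := ⟨GSpace.fn g ⁻¹' V, V.isOpen.preimage (GSpace.continuous_fn g)⟩
    let i : C(W, Z) := ⟨Subtype.val, continuous_subtype_val⟩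
    let k : C(W, V) := ⟨fun w => ⟨GSpace.fn g w, w.2⟩,
      ((GSpace.continuous_fn g).comp continuous_subtype_val).subtype_mk _⟩
    refine ⟨W, hV, free G W, freeDesc i, ?_,
      ⟨fun w => ((1, w) : G × W), by
        change Continuous fun w : W => ((1, w) : G × W)
        fun_prop⟩,
      fun w => one_smul G (w : Z)⟩
    have : freeDesc i ≫ g = freeDesc (s.comp k) ≫ f := by
      apply GSpace.hom_ext
      intro p
      change GSpace.fn g (p.1 • (p.2 : Z)) = GSpace.fn f (p.1 • s (k p.2))
      rw [GSpace.fn_smul, GSpace.fn_smul, hs]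
      rfl
    change S (freeDesc i ≫ g)
    rw [this]
    exact S.downward_closed hf _
  transitive' := by
    intro X S hS R hR x
    obtain ⟨V, hV, Y, f, hf, s, hs⟩ := hS x
    obtain ⟨V', hV', Y', f', hf', s', hs'⟩ := hR hf (s ⟨x, hV⟩)
    let W : Set V := s ⁻¹' V'
    have hW : IsOpen W := V'.isOpen.preimage s.continuous
    let U : Opens X := ⟨Subtype.val '' W, V.isOpen.isOpenMap_subtype_val _ hW⟩
    have hU : ∀ y : U, ∃ h : (y : X) ∈ V, s ⟨y, h⟩ ∈ V' := by
      rintro ⟨_, w, hw, rfl⟩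
      exact ⟨w.2, hw⟩
    refine ⟨U, ⟨⟨x, hV⟩, hV', rfl⟩, Y', f' ≫ f, hf',
      ⟨fun y => s' ⟨s ⟨y, (hU y).1⟩, (hU y).2⟩, ?_⟩, fun y => ?_⟩
    · exact s'.continuous.comp ((s.continuous.comp
        (continuous_subtype_val.subtype_mk _)).subtype_mk _)
    · change GSpace.fn f (GSpace.fn f' (s' ⟨s ⟨y, (hU y).1⟩, (hU y).2⟩)) = y
      rw [hs', hs]

/-- A family of `G`-maps `πᵢ : Xᵢ ⟶ X` is covering for the local-section topology iff every point
of `X` has an open neighbourhood over which some `πᵢ` has a continuous section. -/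
lemma ofArrows_mem_topology_iff [IsTopologicalGroup G] {X : GSpace G} {I : Type*}
    (Y : I → GSpace G) (π : ∀ i, Y i ⟶ X) :
    Sieve.ofArrows Y π ∈ topology G X ↔
      ∀ x : X, ∃ V : Opens X, x ∈ V ∧ ∃ (i : I) (s : C(V, Y i)),
        ∀ v : V, GSpace.fn (π i) (s v) = v := by
  constructor
  · intro h x
    obtain ⟨V, hV, Z, f, ⟨_, a, _, ⟨i⟩, rfl⟩, s, hs⟩ := h x
    exact ⟨V, hV, i, ⟨fun v => GSpace.fn a (s v), (GSpace.continuous_fn a).comp s.continuous⟩, hs⟩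
  · intro h x
    obtain ⟨V, hV, i, s, hs⟩ := h x
    exact ⟨V, hV, Y i, π i, Sieve.ofArrows_mk _ _ i, s, hs⟩

instance [IsTopologicalGroup G] :
    IsGrothendieckAbelian.{u + 1} (Sheaf (topology G) AddCommGrpCat.{u + 1}) := by
  have : EssentiallySmall.{u + 1} (GSpace G) := inferInstance
  exact Sheaf.isGrothendieckAbelian_of_essentiallySmall (topology G) AddCommGrpCat.{u + 1}

/-! ### The sheaves `F_T` -/

section Restriction

variable [IsTopologicalGroup G] (T : Type u) [TopologicalSpace T]

/-- A copy of the topological space `T` in the universe where abelian sheaves on `T_G` take their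
values. -/
abbrev big : TopCat.{u + 1} := TopCat.of (ULift.{u + 1} T)

variable {T} in
/-- An open subset `U` of (the copy of) `T`, as a subspace of `T`. -/
abbrev sub (U : Opens (big T)) : Type u := {t : T // ULift.up t ∈ U}

variable {T} in
/-- The inclusion `G × V ⟶ G × U` for `V ⊆ U`. -/
def freeIncl {V U : Opens (big T)} (h : V ≤ U) : free G (sub V) ⟶ free G (sub U) where
  toFun (p : G × sub V) := (p.1, ⟨p.2.1, h p.2.2⟩)
  continuous_toFun := by
    change Continuous fun p : G × sub V => ((p.1, ⟨p.2.1, h p.2.2⟩) : G × sub U)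
    fun_prop
  map_smul' _ _ := rfl

variable (G) in
/-- The functor sending an open subset `U ⊆ T` to the `G`-space `G × U`. -/
abbrev freeOpens : Opens (big T) ⥤ GSpace G where
  obj U := free G (sub U)
  map i := freeIncl i.le

instance : (freeOpens G T).IsContinuous (Opens.grothendieckTopology (big T)) (topology G) := by
  apply Functor.isContinuous_of_coverPreserving
  · constructor
    intro P U S x hx V₁ V₂ Y f₁ f₂ g₁ g₂ h₁ h₂ e
    have key : ∀ y, (GSpace.fn f₁ y).1 = (GSpace.fn f₂ y).1 ∧
        (GSpace.fn f₁ y).2.1 = (GSpace.fn f₂ y).2.1 := fun y =>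
      ⟨congrArg (fun k : Y ⟶ free G (sub U) => (GSpace.fn k y).1) e,
        congrArg (fun k : Y ⟶ free G (sub U) => ((GSpace.fn k y).2 : sub U).1) e⟩
    let k : Y ⟶ free G (sub (V₁ ⊓ V₂)) :=
      { toFun y := ((GSpace.fn f₁ y).1, ⟨(GSpace.fn f₁ y).2.1, (GSpace.fn f₁ y).2.2, by
          rw [(key y).2]; exact (GSpace.fn f₂ y).2.2⟩)
        continuous_toFun := (continuous_fst.comp (GSpace.continuous_fn f₁)).prodMk
          ((continuous_subtype_val.comp
            (continuous_snd.comp (GSpace.continuous_fn f₁))).subtype_mk _)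
        map_smul' g y := by
          have h : GSpace.fn f₁ (g • y) = g • GSpace.fn f₁ y := GSpace.fn_smul f₁ g y
          have h₁ := congrArg (fun p : free G (sub V₁) => p.1) h
          have h₂ := congrArg (fun p : free G (sub V₁) => p.2.1) h
          exact Prod.ext h₁ (Subtype.ext h₂) }
    have e₁ : f₁ = k ≫ (freeOpens G T).map (Opens.infLELeft V₁ V₂) := rfl
    have e₂ : f₂ = k ≫ (freeOpens G T).map (Opens.infLERight V₁ V₂) :=
      GSpace.hom_ext fun y => Prod.ext (key y).1.symm (Subtype.ext (key y).2.symm)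
    have := hx (Opens.infLELeft V₁ V₂) (Opens.infLERight V₁ V₂) h₁ h₂ (Subsingleton.elim _ _)
    rw [e₁, e₂]
    erw [op_comp, op_comp, P.obj.map_comp, P.obj.map_comp]
    exact congrArg (P.obj.map k.op) this
  · constructor
    intro U S hS p
    obtain ⟨V, i, hV, hp⟩ := hS (ULift.up p.2.1) p.2.2
    refine ⟨⟨{q : G × sub U | ULift.up q.2.1 ∈ V}, V.isOpen.preimage (by fun_prop)⟩, hp,
      free G (sub V), (freeOpens G T).map i, Sieve.image_mem_functorPushforward _ _ hV,
      ⟨fun q => ((q.1.1, ⟨q.1.2.1, q.2⟩) : G × sub V), ?_⟩, fun q => rfl⟩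
    change Continuous fun q : {q : G × sub U | ULift.up q.2.1 ∈ V} =>
      ((q.1.1, ⟨q.1.2.1, q.2⟩) : G × sub V)
    exact (continuous_fst.comp continuous_subtype_val).prodMk
      ((continuous_subtype_val.comp (continuous_snd.comp continuous_subtype_val)).subtype_mk _)

variable (G) in
/-- The functor `F ↦ F_T`, where `F_T` is the sheaf `U ↦ F (G × U)` on the space `T`. -/
def restrict : Sheaf (topology G) AddCommGrpCat.{u + 1} ⥤
    Sheaf (Opens.grothendieckTopology (big T)) AddCommGrpCat.{u + 1} :=
  (freeOpens G T).sheafPushforwardContinuous AddCommGrpCat _ _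

end Restriction

/-- The category of topological spaces in which a morphism `T' ⟶ T` is a pair of continuous maps
`f : T' → T` and `c : T' → G`. Such a pair encodes the `G`-map
`G × T' → G × T`, `(g, t) ↦ (g * c t, f t)`, and every `G`-map `G × T' → G × T` is of this form. -/
structure Twist (G : Type u) : Type (u + 1) where
  space : Type u
  [top : TopologicalSpace space]

attribute [instance] Twist.top

/-- The morphisms of `Twist G`. -/
@[ext]
structure Twist.Hom (T' T : Twist G) : Type u where
  base : C(T'.space, T.space)
  shift : C(T'.space, G)

section Presheafed

variable [IsTopologicalGroup G]

instance : Category (Twist G) where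
  Hom := Twist.Hom
  id T := ⟨.id _, 1⟩
  comp m m' := ⟨m'.base.comp m.base, m.shift * m'.shift.comp m.base⟩
  id_comp m := Twist.Hom.ext rfl (one_mul _)
  comp_id m := Twist.Hom.ext rfl (mul_one _)
  assoc _ _ _ := Twist.Hom.ext rfl (mul_assoc _ _ _)

/-- The continuous map underlying a morphism of `Twist G`. -/
def Twist.bigMap {T' T : Twist G} (m : T' ⟶ T) : big T'.space ⟶ big T.space :=
  TopCat.ofHom ⟨fun t => ULift.up (Twist.Hom.base m t.down), by fun_prop⟩

/-- The `G`-map `G × f⁻¹(U) ⟶ G × U`, `(g, t) ↦ (g * c t, f t)`, attached to `(f, c) : T' ⟶ T`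
and an open subset `U ⊆ T`. -/
def Twist.freeMapOn {T' T : Twist G} (m : T' ⟶ T) (U : Opens (big T.space)) :
    free G (sub ((Opens.map (Twist.bigMap m)).obj U)) ⟶ free G (sub U) :=
  freeMap ⟨fun t => ⟨Twist.Hom.base m t.1, t.2⟩, by fun_prop⟩
    ⟨fun t => Twist.Hom.shift m t.1, by fun_prop⟩

/-- Topological spaces with a presheaf of abelian groups; a morphism `(X, P) ⟶ (Y, Q)` is a
continuous map `f : X → Y` together with a morphism `Q ⟶ f_* P`. -/
abbrev AbSpace : Type (w + 1) := PresheafedSpace.{w, w + 1, w} AddCommGrpCat.{w}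

/-- The space `T` with the sheaf `F_T : U ↦ F (G × U)`. -/
abbrev pairObj (T : Twist G) (F : Sheaf (topology G) AddCommGrpCat.{u + 1}) :
    AbSpace.{u + 1} :=
  ⟨big T.space, ((restrict G T.space).obj F).obj⟩

/-- The morphism `(T', F_T') ⟶ (T, F_T)` attached to `(f, c) : T' ⟶ T`: its underlying map is `f`,
and `F_T ⟶ f_* F_T'` is given by the maps `F (G × U) → F (G × f⁻¹(U))` induced by the `G`-maps
`G × f⁻¹(U) → G × U`, `(g, t) ↦ (g * c t, f t)`. -/
def pairMap {T' T : Twist G} (m : T' ⟶ T) (F : Sheaf (topology G) AddCommGrpCat.{u + 1}) :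
    pairObj T' F ⟶ pairObj T F where
  base := Twist.bigMap m
  c :=
    { app U := F.obj.map (Twist.freeMapOn m U.unop).op
      naturality U V i := by
        refine (F.obj.map_comp _ _).symm.trans ?_
        refine Eq.trans ?_ (F.obj.map_comp _ _)
        rfl }

/-- The functor `T ↦ (F ↦ (T, F_T))`, contravariant in `F`. -/
def pairFunctor : (Twist G)ᵒᵖ ⥤ Sheaf (topology G) AddCommGrpCat.{u + 1} ⥤
    (AbSpace.{u + 1})ᵒᵖ where
  obj T :=
    { obj F := op (pairObj T.unop F)
      map {F F'} φ := Quiver.Hom.op (X := pairObj T.unop F') (Y := pairObj T.unop F)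
        { base := 𝟙 _
          c := ((restrict G T.unop.space).map φ).hom }
      map_id F := by
        apply Quiver.Hom.unop_inj
        refine PresheafedSpace.hext _ _ rfl (heq_of_eq (NatTrans.ext (funext fun U => ?_)))
        rfl
      map_comp φ ψ := by
        apply Quiver.Hom.unop_inj
        refine PresheafedSpace.hext _ _ rfl (heq_of_eq (NatTrans.ext (funext fun U => ?_)))
        rfl }
  map m :=
    { app F := (pairMap m.unop F).op
      naturality F F' φ := by
        apply Quiver.Hom.unop_inj
        refine PresheafedSpace.hext _ _ rfl (heq_of_eq (NatTrans.ext (funext fun U => ?_)))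
        exact (φ.hom.naturality _).symm }
  map_id T := by
    refine NatTrans.ext (funext fun F => ?_)
    apply Quiver.Hom.unop_inj
    refine PresheafedSpace.hext _ _ rfl (heq_of_eq (NatTrans.ext (funext fun U => ?_)))
    refine Eq.trans (congrArg F.obj.map (?_ : _ = 𝟙 _)) (F.obj.map_id _)
    exact congrArg Quiver.Hom.op (GSpace.hom_ext fun p => Prod.ext (mul_one p.1) rfl)
  map_comp m m' := by
    refine NatTrans.ext (funext fun F => ?_)
    apply Quiver.Hom.unop_inj
    refine PresheafedSpace.hext _ _ rfl (heq_of_eq (NatTrans.ext (funext fun U => ?_)))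
    refine Eq.trans (congrArg F.obj.map ?_) (F.obj.map_comp _ _)
    exact congrArg Quiver.Hom.op
      (GSpace.hom_ext fun p => Prod.ext (mul_assoc p.1 _ _).symm rfl)

end Presheafed

/-! ### Alternating sums of coface maps -/

section SemiCosimplicial

/-- A semi-cosimplicial object: the coface maps of a cosimplicial object, without codegeneracies. -/
structure SemiCosimplicial (A : Type u) [Category.{v} A] where
  X : ℕ → A
  δ : ∀ {n : ℕ}, Fin (n + 2) → (X n ⟶ X (n + 1))
  δ_comp_δ : ∀ {n : ℕ} (i j : Fin (n + 2)), i ≤ j →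
    δ i ≫ δ j.succ = δ j ≫ δ i.castSucc

variable {A : Type u} [Category.{v} A]

/-- The image of a semi-cosimplicial object under a functor. -/
def SemiCosimplicial.map {B : Type*} [Category* B] (K : SemiCosimplicial A) (Φ : A ⥤ B) :
    SemiCosimplicial B where
  X n := Φ.obj (K.X n)
  δ i := Φ.map (K.δ i)
  δ_comp_δ i j h := by rw [← Φ.map_comp, ← Φ.map_comp, K.δ_comp_δ i j h]

variable [Preadditive A] (K : SemiCosimplicial A)

/-- The alternating sum of the coface maps. -/
def SemiCosimplicial.d (n : ℕ) : K.X n ⟶ K.X (n + 1) :=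
  ∑ i : Fin (n + 2), (-1 : ℤ) ^ (i : ℕ) • K.δ i

lemma SemiCosimplicial.d_comp_d (n : ℕ) : K.d n ≫ K.d (n + 1) = 0 := by
  simp only [SemiCosimplicial.d, Preadditive.sum_comp, Preadditive.comp_sum,
    Preadditive.zsmul_comp, Preadditive.comp_zsmul, Finset.smul_sum, smul_smul]
  rw [Finset.sum_comm, ← Finset.sum_product', Finset.univ_product_univ]
  let S : Finset (Fin (n + 2) × Fin (n + 3)) := {p | p.1.castSucc < p.2}
  rw [← Finset.sum_add_sum_compl S, ← eq_neg_iff_add_eq_zero, ← Finset.sum_neg_distrib]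
  refine Finset.sum_bij'
    (fun p hp => (p.2.pred (by
      have := (Finset.mem_filter.1 hp).2
      rintro h
      simp [h] at this), p.1.castSucc))
    (fun p hp => (p.2.castLT (by
      have : ¬ p.1.castSucc < p.2 := by simpa [S] using hp
      have h2 := p.1.2
      simp only [Fin.lt_def, Fin.val_castSucc] at this
      lia), p.1.succ)) ?_ ?_ ?_ ?_ ?_
  · rintro ⟨i, j⟩ hp
    have : i.castSucc < j := (Finset.mem_filter.1 hp).2
    simp only [Fin.lt_def, Fin.val_castSucc] at this
    simp only [S, Finset.mem_compl, Finset.mem_filter, Finset.mem_univ, true_and, Fin.lt_def,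
      Fin.val_castSucc, Fin.val_pred]
    lia
  · rintro ⟨i, j⟩ hp
    have : ¬ i.castSucc < j := by simpa [S] using hp
    simp only [Fin.lt_def, Fin.val_castSucc] at this
    simp only [S, Finset.mem_filter, Finset.mem_univ, true_and, Fin.lt_def,
      Fin.val_castSucc, Fin.val_castLT, Fin.val_succ]
    lia
  · rintro ⟨i, j⟩ hp
    simp
  · rintro ⟨i, j⟩ hp
    simp
  · rintro ⟨i, j⟩ hp
    have hij : i.castSucc < j := (Finset.mem_filter.1 hp).2
    obtain ⟨j, rfl⟩ := Fin.exists_succ_eq.2 (Fin.ne_zero_of_lt hij)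
    have h : i ≤ j := by
      simp only [Fin.lt_def, Fin.val_castSucc, Fin.val_succ] at hij
      exact Fin.le_def.2 (by lia)
    simp only [Fin.pred_succ, Fin.val_succ, Fin.val_castSucc, K.δ_comp_δ i j h, pow_succ, ← neg_smul]
    congr 1
    ring

/-- The cochain complex with the alternating sums of the coface maps as differentials. -/
def SemiCosimplicial.complex : CochainComplex A ℕ :=
  CochainComplex.of K.X K.d K.d_comp_d

end SemiCosimplicial

/-! ### The bar construction -/

section Bar
variable {G : Type u} [Group G] [TopologicalSpace G] [IsTopologicalGroup G]

/-- The face maps `G^(n+1) → G^n`: `(g₁, …, g_{n+1}) ↦ (g₂, …, g_{n+1})` for `i = 0`,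
`(g₁, …, gᵢ gᵢ₊₁, …, g_{n+1})` for `1 ≤ i ≤ n` and `(g₁, …, gₙ)` for `i = n + 1`. -/
def faceBase {n : ℕ} (i : Fin (n + 2)) (g : Fin (n + 1) → G) : Fin n → G :=
  Fin.cases (Fin.tail g) (fun j : Fin (n + 1) => Fin.contractNth j (· * ·) g) i

/-- `g₁` for `i = 0` and `1` otherwise. -/
def faceShift {n : ℕ} (i : Fin (n + 2)) (g : Fin (n + 1) → G) : G :=
  if i = 0 then g 0 else 1

lemma continuous_faceBase {n : ℕ} (i : Fin (n + 2)) :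
    Continuous (faceBase (G := G) i) := by
  refine continuous_pi fun k => ?_
  refine Fin.cases ?_ (fun j => ?_) i
  · exact continuous_apply k.succ
  · simp only [faceBase, Fin.cases_succ, Fin.contractNth]
    split_ifs <;> fun_prop

lemma continuous_faceShift {n : ℕ} (i : Fin (n + 2)) :
    Continuous (faceShift (G := G) i) := by
  unfold faceShift
  split_ifs <;> fun_prop

lemma faceBase_zero {n : ℕ} (g : Fin (n + 1) → G) : faceBase 0 g = Fin.tail g := rfl

lemma faceBase_succ {n : ℕ} (j : Fin (n + 1)) (g : Fin (n + 1) → G) :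
    faceBase j.succ g = Fin.contractNth j (· * ·) g := rfl

lemma faceBase_comp {n : ℕ} (i j : Fin (n + 2)) (h : i ≤ j) (g : Fin (n + 2) → G) :
    faceBase i (faceBase j.succ g) = faceBase j (faceBase i.castSucc g) := by
  funext k
  induction i using Fin.cases with
  | zero =>
    rw [Fin.castSucc_zero, faceBase_zero, faceBase_zero, faceBase_succ]
    induction j using Fin.cases with
    | zero => simp [faceBase_zero, Fin.tail, Fin.contractNth]
    | succ j =>
      simp only [faceBase_succ, Fin.tail, Fin.contractNth, Fin.val_succ, add_lt_add_iff_right,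
        add_left_inj]
      rfl
  | succ i =>
    induction j using Fin.cases with
    | zero => simp at h
    | succ j =>
      have hij : (i : ℕ) ≤ j := Fin.succ_le_succ_iff.1 h
      rw [← Fin.succ_castSucc]
      simp only [faceBase_succ, Fin.contractNth, Fin.val_succ, Fin.val_castSucc]
      split_ifs <;> first | rfl | (exfalso; lia) | simp [mul_assoc]

lemma faceShift_comp {n : ℕ} (i j : Fin (n + 2)) (h : i ≤ j) (g : Fin (n + 2) → G) :
    faceShift j.succ g * faceShift i (faceBase j.succ g) =
      faceShift i.castSucc g * faceShift j (faceBase i.castSucc g) := by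
  induction i using Fin.cases with
  | zero =>
    rw [Fin.castSucc_zero, faceBase_zero, faceBase_succ]
    induction j using Fin.cases with
    | zero => simp [faceShift, Fin.tail, Fin.contractNth]
    | succ j => simp [faceShift, Fin.contractNth, Fin.succ_ne_zero]
  | succ i =>
    induction j using Fin.cases with
    | zero => simp at h
    | succ j =>
      rw [← Fin.succ_castSucc]
      simp [faceShift, Fin.succ_ne_zero]

end Bar

/-! ### The second canonical flabby resolution -/

section Godement

/-- The sheaf `C⁰(P)` of discontinuous sections of `P`: its sections over `U` are the families
`(s_x)` with `s_x` in the stalk `P_x` for `x ∈ U`. -/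
def discSections {X : TopCat.{w}} (P : X.Presheaf AddCommGrpCat.{w}) :
    X.Presheaf AddCommGrpCat.{w} where
  obj U := AddCommGrpCat.of (∀ x : U.unop, P.stalk x.1)
  map i := AddCommGrpCat.ofHom
    { toFun s x := s ⟨x.1, i.unop.le x.2⟩
      map_zero' := rfl
      map_add' _ _ := rfl }

/-- The functor `(X, P) ↦ (X, C⁰(P))`. A morphism `(f, φ) : (X, P) ⟶ (Y, Q)` (so that
`φ : Q ⟶ f_* P`) induces `C⁰(Q) ⟶ f_* C⁰(P)` through the maps `Q_{f x} ⟶ P_x`. -/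
def godement : AbSpace.{w} ⥤ AbSpace.{w} where
  obj X := ⟨X.carrier, discSections X.presheaf⟩
  map {X Y} f :=
    { base := f.base
      c :=
        { app U := AddCommGrpCat.ofHom
            { toFun s x := f.stalkMap x.1 (s ⟨f.base x.1, x.2⟩)
              map_zero' := funext fun x => map_zero (f.stalkMap x.1).hom
              map_add' s t := funext fun x => map_add (f.stalkMap x.1).hom _ _ } } }
  map_id X := by
    refine PresheafedSpace.hext _ _ rfl (heq_of_eq (NatTrans.ext (funext fun U => ?_)))
    ext s
    funext x
    exact congrArg (fun k => k.hom (s x)) (PresheafedSpace.stalkMap.id X x.1)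
  map_comp {X Y Z} f g := by
    refine PresheafedSpace.hext _ _ rfl (heq_of_eq (NatTrans.ext (funext fun U => ?_)))
    ext s
    funext x
    exact congrArg (fun k => k.hom (s ⟨_, x.2⟩)) (PresheafedSpace.stalkMap.comp f g x.1)

/-- The embedding `P ⟶ C⁰(P)`, sending a section to the family of its germs. -/
def godementUnit : godement.{w} ⟶ 𝟭 AbSpace.{w} where
  app X :=
    { base := 𝟙 _
      c :=
        { app U := AddCommGrpCat.ofHom
            { toFun s x := X.presheaf.germ U.unop x.1 x.2 s
              map_zero' := funext fun x => map_zero (X.presheaf.germ U.unop x.1 x.2).hom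
              map_add' s t := funext fun x => map_add (X.presheaf.germ U.unop x.1 x.2).hom _ _ }
          naturality U V i := by
            ext s
            funext x
            exact X.presheaf.germ_res_apply i.unop x.1 x.2 s } }
  naturality X Y f := by
    refine PresheafedSpace.hext _ _ rfl (heq_of_eq (NatTrans.ext (funext fun U => ?_)))
    ext s
    funext x
    exact (congrArg (fun k => k.hom s) (PresheafedSpace.stalkMap_germ f U.unop x.1 x.2))

/-- The iterates `(X, P) ↦ (X, C⁰(⋯ C⁰(P)))`, with `n` factors `C⁰`. -/
def godementIter : ℕ → (AbSpace.{w} ⥤ AbSpace.{w})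
  | 0 => 𝟭 _
  | n + 1 => godementIter n ⋙ godement

/-- The map `(C⁰)^n(P) ⟶ (C⁰)^(n+1)(P)` (in `AbSpace` the arrow is reversed) obtained by applying
`i` times `C⁰` to the embedding of `(C⁰)^(n-i)(P)` in `(C⁰)^(n-i+1)(P)`. -/
def godementFace : ∀ n : ℕ, Fin (n + 1) → (godementIter.{w} (n + 1) ⟶ godementIter.{w} n)
  | 0, _ => Functor.whiskerLeft (godementIter 0) godementUnit
  | n + 1, i => Fin.cases (Functor.whiskerLeft (godementIter (n + 1)) godementUnit)
      (fun j => Functor.whiskerRight (godementFace n j) godement) i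

lemma godementFace_succ (n : ℕ) (j : Fin (n + 1)) :
    godementFace.{w} (n + 1) j.succ = Functor.whiskerRight (godementFace n j) godement := rfl

lemma godementFace_comp : ∀ (n : ℕ) (i j : Fin (n + 1)), i ≤ j →
    godementFace.{w} (n + 1) j.succ ≫ godementFace n i =
      godementFace (n + 1) i.castSucc ≫ godementFace n j := by
  intro n
  induction n with
  | zero =>
    intro i j _
    obtain rfl : i = 0 := Fin.fin_one_eq_zero i
    obtain rfl : j = 0 := Fin.fin_one_eq_zero j
    refine NatTrans.ext (funext fun X => ?_)
    exact godementUnit.naturality ((godementFace 0 0).app X)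
  | succ n ih =>
    intro i j h
    induction i using Fin.cases with
    | zero =>
      refine NatTrans.ext (funext fun X => ?_)
      exact godementUnit.naturality ((godementFace (n + 1) j).app X)
    | succ i =>
      induction j using Fin.cases with
      | zero => simp at h
      | succ j =>
        rw [← Fin.succ_castSucc, godementFace_succ, godementFace_succ, godementFace_succ,
          godementFace_succ]
        refine NatTrans.ext (funext fun X => ?_)
        have h' := NatTrans.congr_app (ih i j (Fin.succ_le_succ_iff.1 h)) X
        refine (godement.map_comp _ _).symm.trans (Eq.trans ?_ (godement.map_comp _ _))
        exact congrArg (fun k => godement.map k) h'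

/-- The coface maps between the groups of global sections `Γ(X, (C⁰)^(q+1)(P))`, `q ≥ 0`. -/
def godementCosimplicial : SemiCosimplicial (AbSpace.{w}ᵒᵖ ⥤ AddCommGrpCat.{w}) where
  X q := (godementIter (q + 1)).op ⋙ PresheafedSpace.Γ
  δ {q} i := Functor.whiskerRight (NatTrans.op (godementFace (q + 1) i)) PresheafedSpace.Γ
  δ_comp_δ {q} i j h := by
    have := godementFace_comp (q + 1) i j h
    rw [← Functor.whiskerRight_comp, ← Functor.whiskerRight_comp, ← NatTrans.op_comp,
      ← NatTrans.op_comp, this]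

/-- The functor sending `(X, P)` to the complex `Γ(X, C⁰(P)) → Γ(X, C⁰(C⁰(P))) → ⋯` of global sections
of the second canonical flabby resolution of `P`. -/
def godementComplex : AbSpace.{w}ᵒᵖ ⥤ CochainComplex AddCommGrpCat.{w} ℕ :=
  godementCosimplicial.complex.asFunctor

end Godement

/-! ### The double complex and its hypercohomology -/

section DoubleComplex

variable (G : Type u) [Group G] [TopologicalSpace G] [IsTopologicalGroup G]

/-- The spaces `G^n` with the face maps; the `i`-th face `G^(n+1) → G^n` together with
`faceShift i` encodes the `G`-map
`(g₀, …, g_{n+1}) ↦ (g₀, …, gᵢ gᵢ₊₁, …, g_{n+1})` (resp. `(g₀, …, gₙ)` for `i = n + 1`)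
from `G × G^(n+1)` to `G × G^n`. -/
def bar : SemiCosimplicial (Twist G)ᵒᵖ where
  X n := op ⟨Fin n → G⟩
  δ {n} i := Quiver.Hom.op (X := (⟨Fin (n + 1) → G⟩ : Twist G)) (Y := ⟨Fin n → G⟩)
    ⟨⟨faceBase i, continuous_faceBase i⟩, ⟨faceShift i, continuous_faceShift i⟩⟩
  δ_comp_δ i j h := Quiver.Hom.unop_inj (Twist.Hom.ext
    (ContinuousMap.ext fun g => faceBase_comp i j h g)
    (ContinuousMap.ext fun g => faceShift_comp i j h g))

/-- The double complex `Γ(G^p, T_{q,p})`, functorially in the sheaf `F`: the `p`-th column is the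
complex of global sections of the second canonical flabby resolution `T_{•,p}` of
`F_p : U ↦ F (G × U)` on `G^p`, and the horizontal differentials are the alternating sums of the
maps induced by the face maps `G^(p+1) → G^p`. -/
def doubleComplex : Sheaf (topology G) AddCommGrpCat.{u + 1} ⥤
    HomologicalComplex₂ AddCommGrpCat.{u + 1} (ComplexShape.up ℕ) (ComplexShape.up ℕ) :=
  (((bar G).map pairFunctor).map
    ((Functor.whiskeringRight _ _ _).obj godementComplex)).complex.asFunctor

/-- The usual signs: the total differential is the horizontal one plus `(-1) ^ p` times the
vertical one. -/
instance : ComplexShape.TensorSigns (ComplexShape.up ℕ) where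
  ε' := MonoidHom.mk' (fun i : ℕ => (-1 : ℤˣ) ^ i) (pow_add (-1 : ℤˣ))
  rel_add p q r (hpq : p + 1 = q) := by change p + r + 1 = q + r; lia
  add_rel p q r (hpq : p + 1 = q) := by change r + p + 1 = r + q; lia
  ε'_succ p q (hpq : p + 1 = q) := by
    subst hpq
    change (-1 : ℤˣ) ^ (p + 1) = -((-1 : ℤˣ) ^ p)
    rw [pow_succ, mul_neg, mul_one]

/-- The functor `F ↦ H̃ⁿ(G, F)`, the hypercohomology of the double complex, that is, the cohomology
of its total complex. -/
def hyperH (n : ℕ) : Sheaf (topology G) AddCommGrpCat.{u + 1} ⥤ AddCommGrpCat.{u + 1} :=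
  doubleComplex G ⋙ HomologicalComplex₂.totalFunctor _ _ _ (ComplexShape.up ℕ) ⋙
    HomologicalComplex.homologyFunctor _ _ n

/-- The one-point `G`-space `*`. -/
def point : GSpace G where
  carrier := PUnit
  act :=
    { smul _ x := x
      one_smul _ := rfl
      mul_smul _ _ _ := rfl }
  cont :=
    letI : SMul G PUnit := ⟨fun _ x => x⟩
    ⟨continuous_snd⟩

/-- `*` is a terminal object of the category of `G`-spaces. -/
def pointIsTerminal : IsTerminal (point G) :=
  IsTerminal.ofUniqueHom
    (fun _ => ⟨fun _ => PUnit.unit, continuous_const, fun _ _ => rfl⟩)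
    (fun _ _ => GSpace.hom_ext fun _ => rfl)

/-- The functor `F ↦ Hⁿ(T_G, *, F)`: as the one-point `G`-space `*` is the terminal object of `T_G`,
this is the sheaf cohomology of the whole site. -/
def siteH (n : ℕ) : Sheaf (topology G) AddCommGrpCat.{u + 1} ⥤ AddCommGrpCat.{u + 1} :=
  Sheaf.functorH.{u + 1, u + 1} (topology G) n

/-- The functor `F ↦ H^q(G^p, F_p)`, the sheaf cohomology of the topological space `G^p` with
values in the sheaf `F_p : U ↦ F (G × U)`. -/
def powerH (p q : ℕ) : Sheaf (topology G) AddCommGrpCat.{u + 1} ⥤ AddCommGrpCat.{u + 1} :=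
  restrict G (Fin p → G) ⋙
    Sheaf.functorH.{u + 1, u + 1} (Opens.grothendieckTopology (big (Fin p → G))) q

/-- The functor sending `F` to the `q`-th cohomology of the `p`-th column of the double complex. -/
def columnH (p q : ℕ) : Sheaf (topology G) AddCommGrpCat.{u + 1} ⥤ AddCommGrpCat.{u + 1} :=
  doubleComplex G ⋙ HomologicalComplex.eval _ _ p ⋙ HomologicalComplex.homologyFunctor _ _ q

/-- The map between the `q`-th cohomology groups of the `p`-th and `(p+1)`-st columns induced by the
horizontal differential. -/
def columnD (F : Sheaf (topology G) AddCommGrpCat.{u + 1}) (p q : ℕ) :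
    (columnH G p q).obj F ⟶ (columnH G (p + 1) q).obj F :=
  HomologicalComplex.homologyMap (((doubleComplex G).obj F).d p (p + 1)) q

end DoubleComplex

/-! ### Convergence of first quadrant spectral sequences -/

/-- `E₁^{p,q} ⇒ H^{p+q}`: every `Hⁿ` has a decreasing filtration
`Hⁿ = F⁰Hⁿ ⊇ F¹Hⁿ ⊇ ⋯ ⊇ F^{n+1}Hⁿ = 0` such that `F^p H^{p+q} / F^{p+1} H^{p+q}` is isomorphic to
`E_∞^{p,q}`, i.e. to `E_r^{p,q}` for all `r > max (p, q + 1)` (for such `r` the differentials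
into and out of `E_r^{p,q}` vanish for degree reasons). -/
def Converges (E : CohomologicalSpectralSequenceNat AddCommGrpCat.{w} 1)
    (H : ℕ → AddCommGrpCat.{w}) : Prop :=
  ∃ Fil : ∀ n : ℕ, ℕ → AddSubgroup (H n),
    (∀ n, Antitone (Fil n)) ∧ (∀ n, Fil n 0 = ⊤) ∧ (∀ n, Fil n (n + 1) = ⊥) ∧
    ∀ (p q : ℕ) (r : ℤ) (hr : 1 ≤ r), (p : ℤ) < r → (q : ℤ) + 1 < r →
      Nonempty ((E.page r hr).X (p, q) ≃+
        Fil (p + q) p ⧸ (Fil (p + q) (p + 1)).addSubgroupOf (Fil (p + q) p))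

end LocalSection

end

/-!
Both sides of the first isomorphism are cohomological `δ`-functors on abelian sheaves on `T_G` which
are effaced by injective sheaves, so it suffices to compare them in degree zero
(`DeltaFunctor.nonempty_iso`). For sheaf cohomology this is the long exact sequence of `Ext`
(`deltaSheafH`). For the total complex it amounts to three facts (`deltaOfExact`).

* The double complex is exact in `F` (`totalComplex_shortExact`). A local section `σ` of a covering
  of `G × U` near `(1, x)` extends to the equivariant section `(g, y) ↦ g • σ (1, y)`, so `F ↦ F_p`
  turns epimorphisms into epimorphisms on stalks; and the functor `C⁰` turns sequences exact on
  stalks into sequences exact on sections.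
* The total complex of an injective sheaf `I` is acyclic in positive degrees
  (`isZero_total_of_injective`). Indeed `I` is a presheaf retract of `Y ↦ ∏_{Z ⟶ Y} I(Z)`. This
  shows that the sheaves `I_p` are flasque (`isFlasque_restrict`), so that the columns are acyclic
  (`godementOn_exact_of_isFlasque`), and that the rows `I (G × G^•)` are exact in positive degrees
  (`exists_barD_eq`): on the factor of `f : Z ⟶ G × G^p`, inserting an extra vertex given by a fixed
  equivariant map `Z ⟶ G` is a contracting homotopy.
* In degree zero the total complex has the cohomology `F(*)`
  (`nonempty_sections_iso_hyperH_zero`), by the sheaf condition for the covering `G ⟶ *`.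

On a fixed space, the same comparison of `δ`-functors shows that the Godement complex computes sheaf
cohomology (`nonempty_functorH_iso_godementSheaf`). Here an injective sheaf `P` is a retract of
`C⁰(P)`, and a retraction of `P ⟶ C⁰(P)` yields a contraction of the Godement complex
(`exists_godementComplex_d_eq`). This identifies the cohomology of the columns.

The spectral sequence is that of the total complex filtered by the columns. It is constructed
for any filtered complex of abelian groups whose filtration is finite in each degree
(`Filtration.spectralSequence`, `Filtration.converges`), and its first page is identified with the
cohomology of the columns in `firstPageIso` and `firstPageIso_d`.
-/

noncomputable section

namespace LocalSection

/-! ### Effaceable δ-functors -/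

section DeltaFunctor

variable {A : Type*} [Category* A] [Abelian A] {B : Type*} [Category* B] [Abelian B]

/-- A cohomological `δ`-functor structure on the sequence `H`, effaced by injective objects. Only
the part of the long exact sequence which characterizes `H (n + 1)` in terms of `H n` is
recorded. -/
structure DeltaFunctor (H : ℕ → A ⥤ B) where
  δ {S : ShortComplex A} (hS : S.ShortExact) (n : ℕ) : (H n).obj S.X₃ ⟶ (H (n + 1)).obj S.X₁
  naturality {S S' : ShortComplex A} (hS : S.ShortExact) (hS' : S'.ShortExact) (φ : S ⟶ S')
    (n : ℕ) : δ hS n ≫ (H (n + 1)).map φ.τ₁ = (H n).map φ.τ₃ ≫ δ hS' n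
  zero {S : ShortComplex A} (hS : S.ShortExact) (n : ℕ) : (H n).map S.g ≫ δ hS n = 0
  exact {S : ShortComplex A} (hS : S.ShortExact) (n : ℕ) :
    (ShortComplex.mk _ _ (zero hS n)).Exact
  epi {S : ShortComplex A} (hS : S.ShortExact) (n : ℕ) (h : Injective S.X₂) : Epi (δ hS n)

namespace DeltaFunctor

variable [EnoughInjectives A]

/-- The embedding of `F` in an injective object, completed to a short exact sequence. -/
abbrev effacement (F : A) : ShortComplex A :=
  ShortComplex.mk (Injective.ι F) (cokernel.π (Injective.ι F)) (cokernel.condition _)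

lemma effacement_shortExact (F : A) : (effacement F).ShortExact where
  exact := ShortComplex.exact_cokernel _
  mono_f := inferInstanceAs (Mono (Injective.ι F))
  epi_g := inferInstanceAs (Epi (cokernel.π (Injective.ι F)))

/-- A morphism `F ⟶ F'` extends to the effacements, as the middle term of the target is
injective. -/
lemma exists_effacement_map {F F' : A} (f : F ⟶ F') :
    ∃ φ : effacement F ⟶ effacement F', φ.τ₁ = f := by
  let a : Injective.under F ⟶ Injective.under F' :=
    Injective.factorThru (f ≫ Injective.ι F') (Injective.ι F)
  have ha : Injective.ι F ≫ a = f ≫ Injective.ι F' := Injective.comp_factorThru _ _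
  exact ⟨{
    τ₁ := f
    τ₂ := a
    τ₃ := cokernel.map _ _ f a ha
    comm₁₂ := ha.symm
    comm₂₃ := (cokernel.π_desc _ _ _).symm }, rfl⟩

variable {H H' : ℕ → A ⥤ B} (D : DeltaFunctor H) (D' : DeltaFunctor H')

lemma epi_effacement (F : A) (n : ℕ) : Epi (D.δ (effacement_shortExact F) n) :=
  D.epi _ n (inferInstanceAs (Injective (Injective.under F)))

/-- The component at `F` of the map `H (n + 1) ⟶ H' (n + 1)` induced by `H n ⟶ H' n`. -/
def step {n : ℕ} (e : H n ⟶ H' n) (F : A) : (H (n + 1)).obj F ⟶ (H' (n + 1)).obj F :=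
  have : Epi (ShortComplex.mk _ _ (D.zero (effacement_shortExact F) n)).g := D.epi_effacement F n
  (D.exact (effacement_shortExact F) n).desc
    (e.app _ ≫ D'.δ (effacement_shortExact F) n) (by
      change (H n).map _ ≫ _ = 0
      rw [e.naturality_assoc, D'.zero, comp_zero])

lemma δ_step {n : ℕ} (e : H n ⟶ H' n) (F : A) :
    D.δ (effacement_shortExact F) n ≫ step D D' e F =
      e.app _ ≫ D'.δ (effacement_shortExact F) n :=
  have : Epi (ShortComplex.mk _ _ (D.zero (effacement_shortExact F) n)).g := D.epi_effacement F n
  ShortComplex.Exact.g_desc (D.exact (effacement_shortExact F) n) _ _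

/-- The isomorphism `H (n + 1) ≅ H' (n + 1)` induced by an isomorphism `H n ≅ H' n`. -/
def stepIso {n : ℕ} (e : H n ≅ H' n) : H (n + 1) ≅ H' (n + 1) :=
  NatIso.ofComponents
    (fun F =>
      { hom := step D D' e.hom F
        inv := step D' D e.inv F
        hom_inv_id := by
          have := D.epi_effacement F n
          rw [← cancel_epi (D.δ (effacement_shortExact F) n), reassoc_of% δ_step D D',
            δ_step D' D]
          simp
        inv_hom_id := by
          have := D'.epi_effacement F n
          rw [← cancel_epi (D'.δ (effacement_shortExact F) n), reassoc_of% δ_step D' D,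
            δ_step D D']
          simp })
    (fun {F F'} f => by
      have := D.epi_effacement F n
      obtain ⟨φ, hφ⟩ := exists_effacement_map f
      have h := D.naturality (effacement_shortExact F) (effacement_shortExact F') φ n
      have h' := D'.naturality (effacement_shortExact F) (effacement_shortExact F') φ n
      rw [hφ] at h h'
      dsimp only
      rw [← cancel_epi (D.δ (effacement_shortExact F) n), reassoc_of% h, δ_step D D',
        reassoc_of% δ_step D D' e.hom F, h', e.hom.naturality_assoc])

/-- Two `δ`-functors effaced by injectives which agree in degree `0` agree in all degrees. -/
theorem nonempty_iso (D : DeltaFunctor H) (D' : DeltaFunctor H') (e : H 0 ≅ H' 0) (n : ℕ) :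
    Nonempty (H n ≅ H' n) := by
  induction n with
  | zero => exact ⟨e⟩
  | succ n ih => exact ⟨stepIso D D' ih.some⟩

end DeltaFunctor

/-- The cohomology of an exact complex-valued functor is a `δ`-functor; it is effaced by
injectives if these are sent to complexes which are acyclic in positive degrees. -/
def deltaOfExact (Φ : A ⥤ CochainComplex B ℕ) [Φ.PreservesZeroMorphisms]
    (hΦ : ∀ S : ShortComplex A, S.ShortExact → (S.map Φ).ShortExact)
    (hI : ∀ (I : A) [Injective I] (n : ℕ), IsZero ((Φ.obj I).homology (n + 1))) :
    DeltaFunctor (fun n => Φ ⋙ HomologicalComplex.homologyFunctor B _ n) where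
  δ hS n := (hΦ _ hS).δ n (n + 1) rfl
  naturality hS hS' φ n :=
    HomologicalComplex.HomologySequence.δ_naturality (Φ.mapShortComplex.map φ) (hΦ _ hS)
      (hΦ _ hS') n (n + 1) rfl
  zero hS n := (hΦ _ hS).comp_δ n (n + 1) rfl
  exact hS n := (hΦ _ hS).homology_exact₃ n (n + 1) rfl
  epi hS n _ := ((hΦ _ hS).homology_exact₁ n (n + 1) rfl).epi_f ((hI _ n).eq_of_tgt _ _)

/-- Sheaf cohomology is a `δ`-functor effaced by injectives. -/
def deltaSheafH {C : Type*} [Category* C] (J : GrothendieckTopology C)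
    [HasSheafify J AddCommGrpCat.{w}] [HasExt.{w} (Sheaf J AddCommGrpCat.{w})] :
    DeltaFunctor (fun n => Sheaf.functorH.{w, w} J n) where
  δ hS n := AddCommGrpCat.ofHom (hS.extClass.postcomp _ rfl)
  naturality hS hS' φ n := by
    ext x
    exact (Abelian.Ext.comp_assoc_of_third_deg_zero x _ _ _).trans
      ((congrArg (fun y => Abelian.Ext.comp x y rfl) (hS.extClass_naturality hS' φ)).trans
        (Abelian.Ext.comp_assoc_of_second_deg_zero x _ _ _).symm)
  zero hS n := by
    ext x
    exact (Abelian.Ext.comp_assoc_of_second_deg_zero x _ _ _).trans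
      ((congrArg (fun y => Abelian.Ext.comp x y rfl) hS.comp_extClass).trans
        (Abelian.Ext.comp_zero x _ _ _ rfl))
  exact hS n := Abelian.Ext.covariant_sequence_exact₃' _ hS n (n + 1) rfl
  epi hS n h := by
    refine (Abelian.Ext.covariant_sequence_exact₁' _ hS n (n + 1) rfl).epi_f ?_
    ext x
    exact Abelian.Ext.eq_zero_of_injective _

end DeltaFunctor

/-! ### The spectral sequence of a filtered complex of abelian groups -/

section FilteredComplex

lemma exists_iCycles_eq (S : ShortComplex AddCommGrpCat.{w}) (x : S.X₂) (hx : S.g x = 0) :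
    ∃ z, S.iCycles z = x :=
  (ShortComplex.ab_exact_iff _).1 (ShortComplex.exact_of_f_is_kernel
    (ShortComplex.mk _ _ S.iCycles_g) S.cyclesIsKernel) x hx

lemma iCycles_injective (S : ShortComplex AddCommGrpCat.{w}) : Function.Injective S.iCycles :=
  (AddCommGrpCat.mono_iff_injective _).1 inferInstance

lemma homologyπ_surjective (S : ShortComplex AddCommGrpCat.{w}) :
    Function.Surjective S.homologyπ :=
  (AddCommGrpCat.epi_iff_surjective _).1 inferInstance

lemma homologyπ_eq_zero_iff (S : ShortComplex AddCommGrpCat.{w}) (z : S.cycles) :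
    S.homologyπ z = 0 ↔ ∃ y, S.f y = S.iCycles z := by
  constructor
  · intro hz
    obtain ⟨y, hy⟩ := (ShortComplex.ab_exact_iff _).1 (ShortComplex.exact_of_g_is_cokernel
      (ShortComplex.mk _ _ S.toCycles_comp_homologyπ) S.homologyIsCokernel) z hz
    refine ⟨y, ?_⟩
    rw [← S.toCycles_i, ConcreteCategory.comp_apply]
    exact congrArg _ hy
  · rintro ⟨y, hy⟩
    have : S.toCycles y = z := by
      apply iCycles_injective
      rw [← ConcreteCategory.comp_apply, S.toCycles_i, hy]
    rw [← this, ← ConcreteCategory.comp_apply, S.toCycles_comp_homologyπ]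
    rfl

/-- Computes the homology of a short complex of abelian groups: it is `Q` as soon as there is a
group `M` with homomorphisms `a` onto the cycles and `b` onto `Q`, such that `b` kills exactly the
elements sent to boundaries by `a`. -/
lemma exists_homology_iso (S : ShortComplex AddCommGrpCat.{w}) {M : Type w} [AddCommGroup M]
    {Q : AddCommGrpCat.{w}} (a : M →+ S.X₂) (b : M →+ Q)
    (ha : ∀ x, S.g x = 0 ↔ ∃ m, a m = x) (hb : Function.Surjective b)
    (hab : ∀ m, b m = 0 ↔ ∃ y, S.f y = a m) :
    ∃ e : S.homology ≅ Q, ∀ (z : S.cycles) (m : M), S.iCycles z = a m →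
      e.hom (S.homologyπ z) = b m := by
  have cyc : ∀ z, S.g (S.iCycles z) = 0 := fun z => by
    rw [← ConcreteCategory.comp_apply, S.iCycles_g]; rfl
  -- The graph of the isomorphism, obtained by lifting to `M`.
  choose z hz using fun m : M => exists_iCycles_eq S (a m) ((ha _).2 ⟨m, rfl⟩)
  let l : M →+ S.homology := AddMonoidHom.mk' (fun m => S.homologyπ (z m)) (fun m m' => by
    rw [← map_add]
    congr 1
    apply iCycles_injective
    rw [map_add, hz, hz, hz, map_add])
  have lsurj : Function.Surjective l := fun x => by
    obtain ⟨y, rfl⟩ := homologyπ_surjective S x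
    obtain ⟨m, hm⟩ := (ha _).1 (cyc y)
    refine ⟨m, congrArg S.homologyπ (iCycles_injective S ?_)⟩
    rw [hz, hm]
  have hker : l.ker = b.ker := by
    ext m
    rw [AddMonoidHom.mem_ker, AddMonoidHom.mem_ker, hab, ← hz]
    exact homologyπ_eq_zero_iff S (z m)
  let e : S.homology ≃+ Q := (QuotientAddGroup.quotientKerEquivOfSurjective l lsurj).symm.trans
    ((QuotientAddGroup.quotientAddEquivOfEq hker).trans
      (QuotientAddGroup.quotientKerEquivOfSurjective b hb))
  have he : ∀ m, e (l m) = b m := fun m => by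
    have : (QuotientAddGroup.quotientKerEquivOfSurjective l lsurj).symm (l m) =
        (m : M ⧸ l.ker) := by
      rw [AddEquiv.symm_apply_eq]
      rfl
    change _ = b m
    simp only [e, AddEquiv.trans_apply, this]
    rfl
  refine ⟨e.toAddCommGrpIso, fun y m hy => ?_⟩
  have : y = z m := iCycles_injective S (by rw [hy, hz])
  rw [this]
  exact he m

lemma complex_d_eq_zero_iff {ι : Type*} {c : ComplexShape ι}
    (K : HomologicalComplex AddCommGrpCat.{w} c) (i : ι) (x : K.X i) :
    (K.sc i).g x = 0 ↔ ∀ j, K.d i j x = 0 := by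
  refine ⟨fun h j => ?_, fun h => h _⟩
  by_cases hj : c.Rel i j
  · obtain rfl := c.next_eq' hj
    exact h
  · rw [K.shape _ _ hj]
    rfl

lemma complex_boundary_iff {ι : Type*} {c : ComplexShape ι}
    (K : HomologicalComplex AddCommGrpCat.{w} c) (i : ι) (x : K.X i) :
    (∃ y, (K.sc i).f y = x) ↔ ∃ j, ∃ y, K.d j i y = x := by
  refine ⟨fun ⟨y, hy⟩ => ⟨_, y, hy⟩, fun ⟨j, y, hy⟩ => ?_⟩
  by_cases hj : c.Rel j i
  · obtain rfl := c.prev_eq' hj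
    exact ⟨y, hy⟩
  · rw [K.shape _ _ hj] at hy
    exact ⟨0, (map_zero _).trans hy⟩

lemma complex_homologyπ_eq_zero_iff {ι : Type*} {c : ComplexShape ι}
    (K : HomologicalComplex AddCommGrpCat.{w} c) (i : ι) (z : K.cycles i) :
    K.homologyπ i z = 0 ↔ ∃ j, ∃ y, K.d j i y = K.iCycles i z :=
  (homologyπ_eq_zero_iff (K.sc i) z).trans (complex_boundary_iff K i _)

lemma isZero_homology_of_exact {ι : Type*} {c : ComplexShape ι}
    (K : HomologicalComplex AddCommGrpCat.{w} c) (i : ι)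
    (h : ∀ x : K.X i, (∀ j, K.d i j x = 0) → ∃ j, ∃ y, K.d j i y = x) :
    IsZero (K.homology i) := by
  rw [← HomologicalComplex.exactAt_iff_isZero_homology]
  exact (ShortComplex.ab_exact_iff _).2 fun x hx =>
    (complex_boundary_iff K i x).2 (h x ((complex_d_eq_zero_iff K i x).1 hx))

/-- The version of `exists_homology_iso` for a complex of abelian groups. -/
lemma exists_complex_homology_iso {ι : Type*} {c : ComplexShape ι}
    (K : HomologicalComplex AddCommGrpCat.{w} c) (i : ι) {M : Type w} [AddCommGroup M]
    {Q : AddCommGrpCat.{w}} (a : M →+ K.X i) (b : M →+ Q)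
    (ha : ∀ x, (∀ j, K.d i j x = 0) ↔ ∃ m, a m = x) (hb : Function.Surjective b)
    (hab : ∀ m, b m = 0 ↔ ∃ j, ∃ y, K.d j i y = a m) :
    ∃ e : K.homology i ≅ Q, ∀ (z : K.cycles i) (m : M), K.iCycles i z = a m →
      e.hom (K.homologyπ i z) = b m := by
  exact exists_homology_iso (K.sc i) a b
    (fun x => (complex_d_eq_zero_iff K i x).trans (ha x)) hb
    (fun m => (hab m).trans (complex_boundary_iff K i _).symm)

/-- A decreasing filtration of a cochain complex of abelian groups by subcomplexes, which is
exhausted at the index `0` and vanishes in degree `n` from the index `n + 1` on. -/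
structure Filtration (C : CochainComplex AddCommGrpCat.{w} ℕ) where
  F : ℕ → ∀ n : ℕ, AddSubgroup (C.X n)
  anti (n : ℕ) : Antitone (fun p => F p n)
  zero (n : ℕ) : F 0 n = ⊤
  succ (n : ℕ) : F (n + 1) n = ⊥
  d_mem (p n m : ℕ) (x : C.X n) : x ∈ F p n → C.d n m x ∈ F p m

namespace Filtration

variable {C : CochainComplex AddCommGrpCat.{w} ℕ} (Φ : Filtration C)

lemma d_d (i j k : ℕ) (x : C.X i) : C.d j k (C.d i j x) = 0 := by
  rw [← ConcreteCategory.comp_apply, C.d_comp_d]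
  rfl

lemma d_eq_zero (i j : ℕ) (h : i + 1 ≠ j) (x : C.X i) : C.d i j x = 0 := by
  rw [C.shape i j (by simpa using h)]
  rfl

include Φ in
lemma eq_zero_of_mem {p n : ℕ} (h : n < p) {x : C.X n} (hx : x ∈ Φ.F p n) : x = 0 := by
  have := Φ.anti n (Nat.succ_le_of_lt h) hx
  simpa [Φ.succ] using this

/-- The elements of `F^p` whose differential lies in `F^(p + r)`. -/
def Z (r p n : ℕ) : AddSubgroup (C.X n) :=
  Φ.F p n ⊓ (Φ.F (p + r) (n + 1)).comap (C.d n (n + 1)).hom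

/-- `d (F^(p + 1 - r)) + F^(p + 1)`. The truncated subtraction is harmless since `F^0` is
everything; in degree `0` the differential `C.d (0 - 1) 0` vanishes, as it should. -/
def B (r p n : ℕ) : AddSubgroup (C.X n) :=
  (Φ.F (p + 1 - r) (n - 1)).map (C.d (n - 1) n).hom ⊔ Φ.F (p + 1) n

/-- The term in filtration degree `p` and total degree `n` of the `r`-th page. -/
def E (r p n : ℕ) : Type w := Φ.Z r p n ⧸ (Φ.B r p n).addSubgroupOf (Φ.Z r p n)

instance (r p n : ℕ) : AddCommGroup (Φ.E r p n) :=
  inferInstanceAs (AddCommGroup (Φ.Z r p n ⧸ (Φ.B r p n).addSubgroupOf (Φ.Z r p n)))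

lemma mem_Z {r p n : ℕ} {x : C.X n} :
    x ∈ Φ.Z r p n ↔ x ∈ Φ.F p n ∧ ∀ m, C.d n m x ∈ Φ.F (p + r) m := by
  refine ⟨fun h => ⟨h.1, fun m => ?_⟩, fun h => ⟨h.1, h.2 _⟩⟩
  by_cases hm : n + 1 = m
  · subst hm; exact h.2
  · rw [d_eq_zero _ _ hm]; exact zero_mem _

lemma mem_B {r p n : ℕ} {x : C.X n} :
    x ∈ Φ.B r p n ↔
      ∃ b ∈ Φ.F (p + 1 - r) (n - 1), ∃ c ∈ Φ.F (p + 1) n, C.d (n - 1) n b + c = x := by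
  simp only [B, AddSubgroup.mem_sup, AddSubgroup.mem_map, exists_exists_and_eq_and]

lemma B_mono (r p n : ℕ) : Φ.B r p n ≤ Φ.B (r + 1) p n :=
  sup_le_sup_right (AddSubgroup.map_mono (Φ.anti _ (by lia))) _

lemma d_add_mem_B {r p n k : ℕ} {b : C.X k} (hb : b ∈ Φ.F (p + 1 - r) k) {c : C.X n}
    (hc : c ∈ Φ.F (p + 1) n) : C.d k n b + c ∈ Φ.B r p n := by
  by_cases hk : k + 1 = n
  · subst hk
    exact AddSubgroup.add_mem_sup (AddSubgroup.mem_map_of_mem _ hb) hc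
  · rw [d_eq_zero _ _ hk, zero_add]
    exact AddSubgroup.mem_sup_right hc

lemma mem_B_of_mem {r p n : ℕ} {c : C.X n} (hc : c ∈ Φ.F (p + 1) n) : c ∈ Φ.B r p n :=
  AddSubgroup.mem_sup_right hc

/-- The class of an element of `Z`. -/
def toE (r p n : ℕ) : Φ.Z r p n →+ Φ.E r p n := QuotientAddGroup.mk' _

lemma toE_surjective (r p n : ℕ) : Function.Surjective (Φ.toE r p n) :=
  QuotientAddGroup.mk'_surjective _

lemma toE_eq_zero_iff {r p n : ℕ} (x : Φ.Z r p n) : Φ.toE r p n x = 0 ↔ (x : C.X n) ∈ Φ.B r p n :=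
  QuotientAddGroup.eq_zero_iff _

/-- The restriction of the differential of the complex to `Z`. -/
def dZ (r p n p' n' : ℕ) (h : p + r = p') : Φ.Z r p n →+ Φ.Z r p' n' :=
  ((C.d n n').hom.comp (Φ.Z r p n).subtype).codRestrict _ fun x =>
    Φ.mem_Z.2 ⟨h ▸ (Φ.mem_Z.1 x.2).2 n', fun m => by
      change C.d n' m (C.d n n' x) ∈ _
      rw [d_d]
      exact zero_mem _⟩

@[simp]
lemma coe_dZ (r p n p' n' : ℕ) (h : p + r = p') (x : Φ.Z r p n) :
    (Φ.dZ r p n p' n' h x : C.X n') = C.d n n' (x : C.X n) := rfl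

/-- The differential of the `r`-th page. -/
def dE (r p n p' n' : ℕ) (h : p + r = p') : Φ.E r p n →+ Φ.E r p' n' :=
  QuotientAddGroup.map _ _ (Φ.dZ r p n p' n' h) (by
    intro x hx
    obtain ⟨b, hb, c, hc, hx⟩ := Φ.mem_B.1 hx
    have hx' : C.d (n - 1) n b + c = (x : C.X n) := hx
    change C.d n n' x ∈ Φ.B r p' n'
    rw [← hx', map_add, d_d, zero_add, ← add_zero (C.d n n' c)]
    exact Φ.d_add_mem_B ((show p' + 1 - r = p + 1 by lia) ▸ hc) (zero_mem _))

lemma dE_toE (r p n p' n' : ℕ) (h : p + r = p') (x : Φ.Z r p n) :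
    Φ.dE r p n p' n' h (Φ.toE r p n x) = Φ.toE r p' n' (Φ.dZ r p n p' n' h x) := rfl

lemma toNat_rel {r : ℤ} (hr : 1 ≤ r) {a b : ℕ × ℕ}
    (h : (ComplexShape.spectralSequenceNat ⟨r, 1 - r⟩).Rel a b) :
    a.1 + r.toNat = b.1 ∧ a.1 + a.2 + 1 = b.1 + b.2 := by
  rw [ComplexShape.spectralSequenceNat_rel_iff] at h
  dsimp only at h
  lia

open scoped Classical in
/-- The `r`-th page of the spectral sequence of a filtered complex. -/
def page (r : ℤ) (hr : 1 ≤ r) :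
    HomologicalComplex AddCommGrpCat.{w} (ComplexShape.spectralSequenceNat ⟨r, 1 - r⟩) where
  X a := AddCommGrpCat.of (Φ.E r.toNat a.1 (a.1 + a.2))
  d a b :=
    if h : (ComplexShape.spectralSequenceNat ⟨r, 1 - r⟩).Rel a b then
      AddCommGrpCat.ofHom (Φ.dE r.toNat a.1 (a.1 + a.2) b.1 (b.1 + b.2) (toNat_rel hr h).1)
    else 0
  shape a b h := dif_neg h
  d_comp_d' a b c h h' := by
    rw [dif_pos h, dif_pos h']
    ext x
    obtain ⟨x, rfl⟩ := Φ.toE_surjective _ _ _ x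
    refine (Φ.toE_eq_zero_iff _).2 ?_
    rw [coe_dZ, coe_dZ, d_d]
    exact zero_mem _

lemma page_d (r : ℤ) (hr : 1 ≤ r) {a b : ℕ × ℕ}
    (h : (ComplexShape.spectralSequenceNat ⟨r, 1 - r⟩).Rel a b) :
    (Φ.page r hr).d a b =
      AddCommGrpCat.ofHom (Φ.dE r.toNat a.1 (a.1 + a.2) b.1 (b.1 + b.2) (toNat_rel hr h).1) :=
  dif_pos h

lemma Z_le (r p n : ℕ) : Φ.Z (r + 1) p n ≤ Φ.Z r p n := fun x hx =>
  Φ.mem_Z.2 ⟨(Φ.mem_Z.1 hx).1, fun m => Φ.anti m (by lia) ((Φ.mem_Z.1 hx).2 m)⟩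

/-- The kernel of the differential of the `r`-th page is the image of `Z (r + 1)`. -/
lemma dE_eq_zero_iff {r : ℕ} (p n : ℕ) (x : Φ.E r p n) :
    Φ.dE r p n (p + r) (n + 1) rfl x = 0 ↔
      ∃ m : Φ.Z (r + 1) p n, Φ.toE r p n (AddSubgroup.inclusion (Φ.Z_le r p n) m) = x := by
  obtain ⟨x, rfl⟩ := Φ.toE_surjective _ _ _ x
  rw [dE_toE, toE_eq_zero_iff, coe_dZ]
  constructor
  · intro h
    obtain ⟨(b : C.X n), hb, c, hc, h⟩ := Φ.mem_B.1 h
    have hb' : b ∈ Φ.F (p + 1) n := (show p + r + 1 - r = p + 1 by lia) ▸ hb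
    change C.d n (n + 1) b + c = C.d n (n + 1) x at h
    refine ⟨⟨x - b, Φ.mem_Z.2 ⟨sub_mem (Φ.mem_Z.1 x.2).1 (Φ.anti n (Nat.le_succ p) hb'),
      fun m => ?_⟩⟩, ?_⟩
    · by_cases hm : m = n + 1
      · subst hm
        rw [map_sub, ← h, add_sub_cancel_left]
        exact hc
      · rw [d_eq_zero _ _ (by lia)]
        exact zero_mem _
    · rw [← sub_eq_zero, ← map_sub, toE_eq_zero_iff]
      change x - b - x ∈ _
      rw [sub_sub_cancel_left]
      exact Φ.mem_B_of_mem (neg_mem hb')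
  · rintro ⟨m, hm⟩
    rw [← sub_eq_zero, ← map_sub, toE_eq_zero_iff] at hm
    obtain ⟨b, hb, c, hc, h⟩ := Φ.mem_B.1 hm
    change C.d (n - 1) n b + c = m - x at h
    have h' : C.d n (n + 1) (C.d (n - 1) n b + c) = C.d n (n + 1) (m - x) := congrArg _ h
    rw [map_add, d_d, zero_add, map_sub] at h'
    have : C.d n (n + 1) x = C.d n (n + 1) (-c) + C.d n (n + 1) m := by
      rw [map_neg, h']
      abel
    rw [this]
    exact Φ.d_add_mem_B (neg_mem ((show p + r + 1 - r = p + 1 by lia) ▸ hc))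
      ((Φ.mem_Z.1 m.2).2 _)

/-- An element of `Z (r + 1)` vanishes on the page `r + 1` if and only if its class on the `r`-th
page is a boundary. -/
lemma toE_succ_eq_zero_iff {r : ℕ} (p n : ℕ) (m : Φ.Z (r + 1) p n) :
    Φ.toE (r + 1) p n m = 0 ↔
      ∃ b ∈ Φ.F (p - r) (n - 1), C.d (n - 1) n b - m ∈ Φ.B r p n := by
  rw [toE_eq_zero_iff, mem_B, show p + 1 - (r + 1) = p - r by lia]
  constructor
  · rintro ⟨b, hb, c, hc, h⟩
    refine ⟨b, hb, ?_⟩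
    rw [← h, sub_add_cancel_left]
    exact Φ.mem_B_of_mem (neg_mem hc)
  · rintro ⟨b, hb, h⟩
    obtain ⟨b', hb', c, hc, h⟩ := Φ.mem_B.1 h
    refine ⟨b - b', sub_mem hb (Φ.anti _ (by lia) hb'), -c, neg_mem hc, ?_⟩
    rw [map_sub, ← sub_add_cancel (C.d (n - 1) n b) (m : C.X n), ← h]
    abel

/-- An element of `Z (r + 1)` vanishes on the page `r + 1` if and only if its class
on the `r`-th page is in the image of the differential. -/
lemma toE_succ_eq_zero_iff_exists {r p' k p n : ℕ} (h : p' + r = p) (hk : n - 1 = k)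
    (m : Φ.Z (r + 1) p n) :
    Φ.toE (r + 1) p n m = 0 ↔ ∃ y : Φ.E r p' k,
      Φ.dE r p' k p n h y = Φ.toE r p n (AddSubgroup.inclusion (Φ.Z_le r p n) m) := by
  obtain rfl : p' = p - r := by lia
  subst hk
  rw [toE_succ_eq_zero_iff]
  constructor
  · rintro ⟨b, hb, hbm⟩
    obtain rfl | hn := eq_or_ne n 0
    · rw [d_eq_zero _ _ (by lia), zero_sub, neg_mem_iff] at hbm
      exact ⟨0, (map_zero _).trans ((Φ.toE_eq_zero_iff _).2 hbm).symm⟩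
    obtain ⟨b', hb', c, hc, h'⟩ := Φ.mem_B.1 hbm
    have hd : C.d (n - 1) n (b - b') = m + c := by
      rw [map_sub, ← sub_add_cancel (C.d (n - 1) n b) (m : C.X n), ← h']
      abel
    refine ⟨Φ.toE _ _ _ ⟨b - b', Φ.mem_Z.2
      ⟨sub_mem hb (Φ.anti _ (by lia) hb'), fun k => ?_⟩⟩, ?_⟩
    · rw [show p - r + r = p by lia]
      by_cases hk : k = n
      · subst hk
        rw [hd]
        exact add_mem (Φ.mem_Z.1 m.2).1 (Φ.anti _ (Nat.le_succ p) hc)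
      · rw [d_eq_zero _ _ (by lia)]
        exact zero_mem _
    · rw [dE_toE, ← sub_eq_zero, ← map_sub, toE_eq_zero_iff]
      change C.d (n - 1) n (b - b') - m ∈ _
      rw [hd, add_sub_cancel_left]
      exact Φ.mem_B_of_mem hc
  · rintro ⟨y, hy⟩
    obtain ⟨y, rfl⟩ := Φ.toE_surjective _ _ _ y
    refine ⟨y, (Φ.mem_Z.1 y.2).1, ?_⟩
    rw [dE_toE, ← sub_eq_zero, ← map_sub, toE_eq_zero_iff] at hy
    exact hy

/-- For `p < r`, passing from `Z (r + 1)` to the page `r + 1` kills the same elements as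
passing to the `r`-th page. -/
lemma toE_succ_eq_zero_iff_of_lt {r p n : ℕ} (h : p < r) (m : Φ.Z (r + 1) p n) :
    Φ.toE (r + 1) p n m = 0 ↔ Φ.toE r p n (AddSubgroup.inclusion (Φ.Z_le r p n) m) = 0 := by
  rw [toE_eq_zero_iff, toE_eq_zero_iff, B, B, show p + 1 - (r + 1) = p + 1 - r by lia]
  rfl

/-- The homology of the `r`-th page is the next page. -/
lemma exists_page_homology_iso (r : ℤ) (hr : 1 ≤ r) (r' : ℤ) (hr' : r + 1 = r') (a : ℕ × ℕ) :
    Nonempty ((Φ.page r hr).homology a ≅ (Φ.page r' (by lia)).X a) := by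
  obtain rfl := hr'
  have hn : (r + 1).toNat = r.toNat + 1 := by lia
  change Nonempty (_ ≅ AddCommGrpCat.of (Φ.E (r + 1).toNat a.1 (a.1 + a.2)))
  rw [hn]
  refine ⟨(exists_complex_homology_iso (Φ.page r hr) a
    (Q := AddCommGrpCat.of (Φ.E (r.toNat + 1) a.1 (a.1 + a.2)))
    ((Φ.toE r.toNat a.1 (a.1 + a.2)).comp (AddSubgroup.inclusion (Φ.Z_le _ _ _)))
    (Φ.toE (r.toNat + 1) a.1 (a.1 + a.2)) ?_ (Φ.toE_surjective _ _ _) ?_).choose⟩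
  · intro (x : Φ.E r.toNat a.1 (a.1 + a.2))
    refine Iff.trans ?_ (Φ.dE_eq_zero_iff _ _ x)
    constructor
    · intro h
      by_cases hq : r.toNat ≤ a.2 + 1
      · have hb : (ComplexShape.spectralSequenceNat ⟨r, 1 - r⟩).Rel a
            (a.1 + r.toNat, a.2 + 1 - r.toNat) := by
          rw [ComplexShape.spectralSequenceNat_rel_iff]
          dsimp only
          lia
        have := h (a.1 + r.toNat, a.2 + 1 - r.toNat)
        rw [Φ.page_d r hr hb] at this
        have hn : a.1 + r.toNat + (a.2 + 1 - r.toNat) = a.1 + a.2 + 1 := by lia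
        change Φ.dE r.toNat a.1 (a.1 + a.2) (a.1 + r.toNat)
          (a.1 + r.toNat + (a.2 + 1 - r.toNat)) rfl x = 0 at this
        rwa [hn] at this
      · -- The target vanishes, since `F^(p + r)` is zero in degree `p + q + 1`.
        obtain ⟨x, rfl⟩ := Φ.toE_surjective _ _ _ x
        rw [dE_toE]
        convert map_zero (Φ.toE r.toNat (a.1 + r.toNat) (a.1 + a.2 + 1))
        exact Subtype.ext (Φ.eq_zero_of_mem (by lia) ((Φ.mem_Z.1 x.2).2 _))
    · intro h b
      by_cases hb : (ComplexShape.spectralSequenceNat ⟨r, 1 - r⟩).Rel a b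
      · rw [Φ.page_d r hr hb]
        obtain ⟨h₁, h₂⟩ := toNat_rel hr hb
        change Φ.dE _ _ _ b.1 (b.1 + b.2) _ x = 0
        generalize b.1 + b.2 = n' at h₂ ⊢
        generalize b.1 = p' at h₁ ⊢
        subst h₁ h₂
        exact h
      · rw [(Φ.page r hr).shape _ _ hb]
        rfl
  · intro m
    by_cases hra : r.toNat ≤ a.1
    · constructor
      · intro h
        by_cases hn : a.1 + a.2 = 0
        · obtain ⟨y, hy⟩ := (Φ.toE_succ_eq_zero_iff_exists (Nat.sub_add_cancel hra) rfl m).1 h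
          obtain ⟨y, rfl⟩ := Φ.toE_surjective _ _ _ y
          have hz : Φ.dE r.toNat (a.1 - r.toNat) (a.1 + a.2 - 1) a.1 (a.1 + a.2)
              (Nat.sub_add_cancel hra) (Φ.toE _ _ _ y) = 0 := by
            rw [dE_toE, toE_eq_zero_iff, coe_dZ, d_eq_zero _ _ (by lia)]
            exact zero_mem _
          exact ⟨a, 0, (map_zero _).trans (hz.symm.trans hy)⟩
        · have hb : (ComplexShape.spectralSequenceNat ⟨r, 1 - r⟩).Rel
              (a.1 - r.toNat, a.2 + r.toNat - 1) a := by
            rw [ComplexShape.spectralSequenceNat_rel_iff]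
            dsimp only
            lia
          obtain ⟨y, hy⟩ := (Φ.toE_succ_eq_zero_iff_exists (Nat.sub_add_cancel hra)
            (show _ = a.1 - r.toNat + (a.2 + r.toNat - 1) by lia) m).1 h
          refine ⟨(a.1 - r.toNat, a.2 + r.toNat - 1), y, ?_⟩
          rw [Φ.page_d r hr hb]
          exact hy
      · rintro ⟨b, y, hy⟩
        by_cases hb : (ComplexShape.spectralSequenceNat ⟨r, 1 - r⟩).Rel b a
        · obtain ⟨h₁, h₂⟩ := toNat_rel hr hb
          rw [Φ.page_d r hr hb] at hy
          exact (Φ.toE_succ_eq_zero_iff_exists h₁ (by lia) m).2 ⟨y, hy⟩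
        · rw [(Φ.page r hr).shape _ _ hb] at hy
          rw [toE_eq_zero_iff]
          exact B_mono _ _ _ _ ((Φ.toE_eq_zero_iff _).1 hy.symm)
    · rw [toE_succ_eq_zero_iff_of_lt _ (by lia)]
      constructor
      · intro h
        exact ⟨a, 0, (map_zero _).trans h.symm⟩
      · rintro ⟨b, y, hy⟩
        refine hy.symm.trans ?_
        rw [(Φ.page r hr).shape _ _ (by
          rw [ComplexShape.spectralSequenceNat_rel_iff]
          lia)]
        rfl

/-- The spectral sequence of a filtered complex. -/
def spectralSequence : CohomologicalSpectralSequenceNat AddCommGrpCat.{w} 1 where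
  page r hr := Φ.page r hr
  iso r r' a h hr := (Φ.exists_page_homology_iso r hr r' h a).some

/-- The subgroup `F^p H^n` of classes of cocycles lying in `F^p`, transported along an isomorphism
between `H n` and the cohomology of the complex. -/
def cohomologyFiltration {H : ℕ → AddCommGrpCat.{w}} (e : ∀ n, C.homology n ≅ H n) (n p : ℕ) :
    AddSubgroup (H n) :=
  ((Φ.F p n).comap (C.iCycles n).hom).map (C.homologyπ n ≫ (e n).hom).hom

lemma mem_cohomologyFiltration {H : ℕ → AddCommGrpCat.{w}} {e : ∀ n, C.homology n ≅ H n}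
    {n p : ℕ} {x : H n} : x ∈ Φ.cohomologyFiltration e n p ↔
      ∃ z : C.cycles n, C.iCycles n z ∈ Φ.F p n ∧ (e n).hom (C.homologyπ n z) = x := Iff.rfl

/-- The spectral sequence of a filtered complex converges to the cohomology of the complex. -/
theorem converges {H : ℕ → AddCommGrpCat.{w}} (e : ∀ n, C.homology n ≅ H n) :
    Converges Φ.spectralSequence H := by
  refine ⟨Φ.cohomologyFiltration e, fun n p p' h => ?_, fun n => ?_, fun n => ?_, ?_⟩
  · exact AddSubgroup.map_mono (AddSubgroup.comap_mono (Φ.anti n h))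
  · refine top_unique fun x _ => ?_
    obtain ⟨z, hz⟩ := homologyπ_surjective (C.sc n) ((e n).inv x)
    refine ⟨z, by rw [Φ.zero]; trivial, ?_⟩
    change (e n).hom ((C.sc n).homologyπ z) = x
    rw [hz]
    exact Iso.inv_hom_id_apply (e n) x
  · refine bot_unique ?_
    rintro _ ⟨z, hz, rfl⟩
    have hz' : C.iCycles n z = 0 := Φ.eq_zero_of_mem (Nat.lt_succ_self n) hz
    obtain rfl : z = 0 := iCycles_injective (C.sc n) (hz'.trans (map_zero _).symm)
    exact map_zero _
  · intro p q r hr hp hq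
    let n := p + q
    have hd : ∀ (x : Φ.Z r.toNat p n) (m : ℕ), C.d n m x = 0 := fun x m => by
      by_cases hm : n + 1 = m
      · subst hm
        exact Φ.eq_zero_of_mem (by lia) ((Φ.mem_Z.1 x.2).2 _)
      · exact d_eq_zero _ _ hm _
    let l : AddCommGrpCat.of (Φ.Z r.toNat p n) ⟶ C.cycles n :=
      C.liftCycles (AddCommGrpCat.ofHom (Φ.Z r.toNat p n).subtype) (n + 1) (by simp) (by
        ext x
        exact hd x _)
    have hl : ∀ x : Φ.Z r.toNat p n, C.iCycles n (l x) = x := fun x => by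
      rw [← ConcreteCategory.comp_apply, C.liftCycles_i]
      rfl
    let f : Φ.Z r.toNat p n →+ Φ.cohomologyFiltration e n p :=
      (l ≫ C.homologyπ n ≫ (e n).hom).hom.codRestrict _ fun x =>
        ⟨l x, by
          change C.iCycles n (l x) ∈ Φ.F p n
          rw [hl]
          exact (Φ.mem_Z.1 x.2).1, rfl⟩
    let g : Φ.Z r.toNat p n →+ Φ.cohomologyFiltration e n p ⧸
        (Φ.cohomologyFiltration e n (p + 1)).addSubgroupOf (Φ.cohomologyFiltration e n p) :=
      (QuotientAddGroup.mk' _).comp f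
    have hg : Function.Surjective g := by
      refine (QuotientAddGroup.mk'_surjective _).comp ?_
      rintro ⟨_, z, hz, rfl⟩
      have hz' : ∀ m, C.d n m (C.iCycles n z) = 0 := fun m => by
        rw [← ConcreteCategory.comp_apply, C.iCycles_d]
        rfl
      refine ⟨⟨C.iCycles n z, Φ.mem_Z.2 ⟨hz, fun m => by rw [hz']; exact zero_mem _⟩⟩,
        Subtype.ext ?_⟩
      refine congrArg (C.homologyπ n ≫ (e n).hom) (iCycles_injective (C.sc n) ?_)
      exact hl _
    have hker : (Φ.B r.toNat p n).addSubgroupOf (Φ.Z r.toNat p n) = g.ker := by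
      ext x
      rw [AddSubgroup.mem_addSubgroupOf, AddMonoidHom.mem_ker, Φ.mem_B]
      refine Iff.trans ?_ (QuotientAddGroup.eq_zero_iff (f x)).symm
      rw [AddSubgroup.mem_addSubgroupOf, mem_cohomologyFiltration]
      have inj : Function.Injective (e n).hom :=
        (AddCommGrpCat.mono_iff_injective _).1 inferInstance
      constructor
      · rintro ⟨b, -, c, hc, h⟩
        have hcZ : c ∈ Φ.Z r.toNat p n := Φ.mem_Z.2 ⟨Φ.anti _ (Nat.le_succ p) hc, fun m => by
          have := congrArg (C.d n m) h
          rw [map_add, d_d, zero_add, hd x] at this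
          rw [this]
          exact zero_mem _⟩
        refine ⟨l ⟨c, hcZ⟩, ?_, congrArg (e n).hom ?_⟩
        · rw [hl]
          exact hc
        · change C.homologyπ n _ = C.homologyπ n (l x)
          rw [← sub_eq_zero, ← map_sub, complex_homologyπ_eq_zero_iff]
          refine ⟨_, -b, ?_⟩
          rw [map_sub, hl, hl, map_neg, ← h]
          abel
      · rintro ⟨z, hz, h⟩
        have h' : C.homologyπ n z = C.homologyπ n (l x) := inj h
        rw [eq_comm, ← sub_eq_zero, ← map_sub, complex_homologyπ_eq_zero_iff] at h'
        obtain ⟨k, b, hb⟩ := h'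
        rw [map_sub, hl] at hb
        by_cases hk : k + 1 = n
        · obtain rfl : k = n - 1 := by lia
          refine ⟨b, ?_, _, hz, by rw [hb, sub_add_cancel]⟩
          rw [show p + 1 - r.toNat = 0 by lia, Φ.zero]
          trivial
        · rw [d_eq_zero _ _ hk] at hb
          exact ⟨0, zero_mem _, _, hz, by rw [map_zero, hb, sub_add_cancel]⟩
    exact ⟨(QuotientAddGroup.quotientAddEquivOfEq hker).trans
      (QuotientAddGroup.quotientKerEquivOfSurjective g hg)⟩

end Filtration
end FilteredComplex

/-! ### Total complexes of first quadrant double complexes of abelian groups -/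

section TotalComplex

variable (K : HomologicalComplex₂ AddCommGrpCat.{w} (ComplexShape.up ℕ) (ComplexShape.up ℕ))

/-- The total complex of a double complex. -/
abbrev tot : CochainComplex AddCommGrpCat.{w} ℕ := K.total (ComplexShape.up ℕ)

/-- The inclusion of a summand in the total complex. -/
def totι (p q n : ℕ) (h : p + q = n) : (K.X p).X q ⟶ (tot K).X n :=
  K.ιTotal (ComplexShape.up ℕ) p q n h

/-- The projection of the total complex to a summand; it is zero if the degrees do not match. -/
def totπ (p q n : ℕ) : (tot K).X n ⟶ (K.X p).X q :=
  K.totalDesc fun p' q' _ =>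
    if h : p' = p ∧ q' = q then eqToHom (by rw [h.1, h.2]) else 0

lemma totι_totπ (p q n : ℕ) (h : p + q = n) : totι K p q n h ≫ totπ K p q n = 𝟙 _ := by
  rw [totι, totπ, HomologicalComplex₂.ι_totalDesc, dif_pos ⟨rfl, rfl⟩, eqToHom_refl]

lemma totι_totπ_of_ne (p q p' q' n : ℕ) (h : p + q = n) (hp : ¬(p = p' ∧ q = q')) :
    totι K p q n h ≫ totπ K p' q' n = 0 := by
  rw [totι, totπ, HomologicalComplex₂.ι_totalDesc, dif_neg hp]

lemma totπ_eq_zero (p q n : ℕ) (h : p + q ≠ n) : totπ K p q n = 0 := by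
  refine HomologicalComplex₂.total.hom_ext _ fun p' q' h' => ?_
  rw [totπ, HomologicalComplex₂.ι_totalDesc, comp_zero, dif_neg]
  rintro ⟨rfl, rfl⟩
  exact h h'

lemma tot_hom_ext {A : AddCommGrpCat.{w}} {n : ℕ} {f g : (tot K).X n ⟶ A}
    (h : ∀ p q (h : p + q = n), totι K p q n h ≫ f = totι K p q n h ≫ g) : f = g :=
  HomologicalComplex₂.total.hom_ext _ fun p q hpq => h p q hpq

lemma totι_d (p q n n' : ℕ) (h : p + q = n) (h' : n + 1 = n') :
    totι K p q n h ≫ (tot K).d n n' =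
      (K.d p (p + 1)).f q ≫ totι K (p + 1) q n' (by lia) +
        (-1 : ℤˣ) ^ p • ((K.X p).d q (q + 1) ≫ totι K p (q + 1) n' (by lia)) := by
  rw [totι, HomologicalComplex₂.total_d, Preadditive.comp_add, HomologicalComplex₂.ι_D₁,
    HomologicalComplex₂.ι_D₂,
    K.d₁_eq (ComplexShape.up ℕ) (show (ComplexShape.up ℕ).Rel p (p + 1) from rfl) q n' (by
      change p + 1 + q = n'; lia),
    K.d₂_eq (ComplexShape.up ℕ) p (show (ComplexShape.up ℕ).Rel q (q + 1) from rfl) n' (by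
      change p + (q + 1) = n'; lia)]
  congr 1
  exact one_smul _ _

/-- The components of the total differential. The truncated subtractions are harmless, since
the differentials `d (0 - 1) 0` vanish. -/
lemma tot_d_totπ (p q n n' : ℕ) (h : n + 1 = n') (hpq : p + q = n') :
    (tot K).d n n' ≫ totπ K p q n' =
      totπ K (p - 1) q n ≫ (K.d (p - 1) p).f q +
        (-1 : ℤˣ) ^ p • (totπ K p (q - 1) n ≫ (K.X p).d (q - 1) q) := by
  refine tot_hom_ext K fun i j hij => ?_
  rw [← Category.assoc, totι_d K i j n n' hij h, Preadditive.add_comp, Preadditive.comp_add,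
    Linear.units_smul_comp, Linear.comp_units_smul, Category.assoc, Category.assoc,
    ← Category.assoc (totι K i j n hij), ← Category.assoc (totι K i j n hij)]
  congr 1
  · by_cases hi : i + 1 = p ∧ j = q
    · obtain ⟨rfl, rfl⟩ := hi
      rw [totι_totπ, Category.comp_id]
      change _ = (totι K i j n hij ≫ totπ K i j n) ≫ (K.d i (i + 1)).f j
      rw [totι_totπ, Category.id_comp]
    · rw [totι_totπ_of_ne _ _ _ _ _ _ _ hi, comp_zero]
      by_cases hi' : i = p - 1 ∧ j = q
      · obtain rfl : p = 0 := by lia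
        rw [K.shape _ _ (by simp)]
        exact comp_zero.symm
      · rw [totι_totπ_of_ne _ _ _ _ _ _ _ hi', zero_comp]
  · by_cases hi : i = p ∧ j + 1 = q
    · obtain ⟨rfl, rfl⟩ := hi
      rw [totι_totπ, Category.comp_id]
      change _ = _ • ((totι K i j n hij ≫ totπ K i j n) ≫ (K.X i).d j (j + 1))
      rw [totι_totπ, Category.id_comp]
    · rw [totι_totπ_of_ne _ _ _ _ _ _ _ hi, comp_zero, smul_zero]
      by_cases hi' : i = p ∧ j = q - 1
      · obtain rfl : q = 0 := by lia
        rw [(K.X p).shape _ _ (by simp), comp_zero, smul_zero]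
      · rw [totι_totπ_of_ne _ _ _ _ _ _ _ hi', zero_comp, smul_zero]

lemma tot_sum (n : ℕ) :
    ∑ a : Finset.HasAntidiagonal.antidiagonal n, totπ K a.1.1 a.1.2 n ≫
      totι K a.1.1 a.1.2 n (Finset.HasAntidiagonal.mem_antidiagonal.1 a.2) = 𝟙 _ := by
  refine tot_hom_ext K fun p q h => ?_
  rw [Preadditive.comp_sum, Category.comp_id, Finset.sum_eq_single
    ⟨(p, q), Finset.HasAntidiagonal.mem_antidiagonal.2 h⟩]
  · rw [← Category.assoc, totι_totπ, Category.id_comp]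
  · rintro ⟨⟨p', q'⟩, h'⟩ _ hne
    rw [← Category.assoc, totι_totπ_of_ne, zero_comp]
    rintro ⟨rfl, rfl⟩
    exact hne rfl
  · intro h
    exact absurd (Finset.mem_univ _) h

lemma totπ_totι_apply (p q n : ℕ) (h : p + q = n) (y : (K.X p).X q) :
    totπ K p q n (totι K p q n h y) = y := by
  rw [← ConcreteCategory.comp_apply, totι_totπ]
  rfl

lemma totπ_totι_apply_of_ne (p q p' q' n : ℕ) (h : p + q = n) (hp : ¬(p = p' ∧ q = q'))
    (y : (K.X p).X q) : totπ K p' q' n (totι K p q n h y) = 0 := by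
  rw [← ConcreteCategory.comp_apply, totι_totπ_of_ne _ _ _ _ _ _ _ hp]
  rfl

lemma totπ_d (p q n n' : ℕ) (h : n + 1 = n') (hpq : p + q = n') (x : (tot K).X n) :
    totπ K p q n' ((tot K).d n n' x) =
      (K.d (p - 1) p).f q (totπ K (p - 1) q n x) +
        (-1 : ℤˣ) ^ p • (K.X p).d (q - 1) q (totπ K p (q - 1) n x) := by
  have := ConcreteCategory.congr_hom (tot_d_totπ K p q n n' h hpq) x
  exact this

lemma tot_ext {n : ℕ} {x y : (tot K).X n}
    (h : ∀ p q, p + q = n → totπ K p q n x = totπ K p q n y) : x = y := by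
  have key : ∀ x : (tot K).X n, x = ∑ a : Finset.HasAntidiagonal.antidiagonal n,
      totι K a.1.1 a.1.2 n (Finset.HasAntidiagonal.mem_antidiagonal.1 a.2)
        (totπ K a.1.1 a.1.2 n x) := fun x => by
    have := congrArg (fun f => AddCommGrpCat.homAddEquiv f x) (tot_sum K n)
    simp only [map_sum, AddMonoidHom.finsetSum_apply] at this
    exact this.symm
  rw [key x, key y]
  exact Finset.sum_congr rfl fun a _ => by
    rw [h _ _ (Finset.HasAntidiagonal.mem_antidiagonal.1 a.2)]

/-- An element of the total complex may be prescribed by its components. -/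
lemma exists_tot {n : ℕ} (y : ∀ p q, p + q = n → (K.X p).X q) :
    ∃ x : (tot K).X n, ∀ p q h, totπ K p q n x = y p q h := by
  refine ⟨∑ a : Finset.HasAntidiagonal.antidiagonal n,
    totι K a.1.1 a.1.2 n (Finset.HasAntidiagonal.mem_antidiagonal.1 a.2)
      (y _ _ (Finset.HasAntidiagonal.mem_antidiagonal.1 a.2)), fun p q h => ?_⟩
  rw [map_sum, Finset.sum_eq_single ⟨(p, q), Finset.HasAntidiagonal.mem_antidiagonal.2 h⟩]
  · exact totπ_totι_apply _ _ _ _ _ _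
  · rintro ⟨⟨p', q'⟩, h'⟩ _ hne
    refine totπ_totι_apply_of_ne _ _ _ _ _ _ _ ?_ _
    rintro ⟨rfl, rfl⟩
    exact hne rfl
  · intro h
    exact absurd (Finset.mem_univ _) h

lemma totπ_map {K L : HomologicalComplex₂ AddCommGrpCat.{w} (ComplexShape.up ℕ)
    (ComplexShape.up ℕ)} (φ : K ⟶ L) (p q n : ℕ) (x : (tot K).X n) :
    totπ L p q n ((HomologicalComplex₂.total.map φ (ComplexShape.up ℕ)).f n x) =
      (φ.f p).f q (totπ K p q n x) := by
  refine ConcreteCategory.congr_hom (f := (HomologicalComplex₂.total.map φ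
    (ComplexShape.up ℕ)).f n ≫ totπ L p q n) (g := totπ K p q n ≫ (φ.f p).f q) ?_ x
  refine tot_hom_ext K fun i j h => ?_
  rw [totι, HomologicalComplex₂.ιTotal_map_assoc]
  change _ ≫ totι L i j n h ≫ _ = totι K i j n h ≫ _
  by_cases hi : i = p ∧ j = q
  · obtain ⟨rfl, rfl⟩ := hi
    rw [totι_totπ, ← Category.assoc, totι_totπ, Category.comp_id, Category.id_comp]
  · rw [totι_totπ_of_ne _ _ _ _ _ _ _ hi, ← Category.assoc, totι_totπ_of_ne _ _ _ _ _ _ _ hi,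
      zero_comp, comp_zero]

instance : (HomologicalComplex₂.totalFunctor AddCommGrpCat.{w} (ComplexShape.up ℕ)
    (ComplexShape.up ℕ) (ComplexShape.up ℕ)).PreservesZeroMorphisms where
  map_zero K L := by
    ext n x
    refine tot_ext L fun p q h => (totπ_map _ _ _ _ _).trans ?_
    change 0 = totπ L p q n 0
    rw [map_zero]

/-- Totalization sends short exact sequences of double complexes to short exact sequences. -/
lemma total_shortExact (S : ShortComplex (HomologicalComplex₂ AddCommGrpCat.{w}
      (ComplexShape.up ℕ) (ComplexShape.up ℕ)))
    (inj : ∀ p q, Function.Injective ((S.f.f p).f q))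
    (exact : ∀ p q x, (S.g.f p).f q x = 0 → ∃ y, (S.f.f p).f q y = x)
    (surj : ∀ p q, Function.Surjective ((S.g.f p).f q)) :
    (S.map (HomologicalComplex₂.totalFunctor AddCommGrpCat.{w} (ComplexShape.up ℕ)
      (ComplexShape.up ℕ) (ComplexShape.up ℕ))).ShortExact := by
  refine HomologicalComplex.shortExact_of_degreewise_shortExact _ fun n => ?_
  have zero : ∀ p q y, (S.g.f p).f q ((S.f.f p).f q y) = 0 := fun p q y => by
    have := congrArg (fun k => (k.f p).f q y) S.zero
    exact this
  refine ShortComplex.ShortExact.mk' ?_ ?_ ?_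
  · refine (ShortComplex.ab_exact_iff _).2 fun x hx => ?_
    change (HomologicalComplex₂.total.map S.g (ComplexShape.up ℕ)).f n x = 0 at hx
    have : ∀ p q, p + q = n → ∃ y, (S.f.f p).f q y = totπ S.X₂ p q n x := fun p q _ =>
      exact p q _ ((totπ_map S.g p q n x).symm.trans (by rw [hx, map_zero]))
    choose y hy using this
    obtain ⟨z, hz⟩ := exists_tot S.X₁ y
    exact ⟨z, tot_ext _ fun p q h => (totπ_map S.f p q n z).trans (by rw [hz p q h, hy])⟩
  · refine (AddCommGrpCat.mono_iff_injective _).2 fun x y hxy => tot_ext _ fun p q _ => inj p q ?_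
    exact (totπ_map S.f p q n x).symm.trans ((congrArg _ hxy).trans (totπ_map S.f p q n y))
  · refine (AddCommGrpCat.epi_iff_surjective _).2 fun x => ?_
    choose y hy using fun p q (_ : p + q = n) => surj p q (totπ S.X₃ p q n x)
    obtain ⟨z, hz⟩ := exists_tot S.X₂ y
    exact ⟨z, tot_ext _ fun p q h => (totπ_map S.g p q n z).trans (by rw [hz p q h, hy])⟩

/-- The filtration of the total complex by the columns. -/
def columnFiltration : Filtration (tot K) where
  F p n :=
    { carrier := {x | ∀ i < p, ∀ j, totπ K i j n x = 0}
      zero_mem' := fun i _ j => map_zero _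
      add_mem' := fun hx hy i hi j => by rw [map_add, hx i hi j, hy i hi j, add_zero]
      neg_mem' := fun hx i hi j => by rw [map_neg, hx i hi j, neg_zero] }
  anti n p p' h x hx i hi j := hx i (hi.trans_le h) j
  zero n := top_unique fun x _ i hi => absurd hi (Nat.not_lt_zero i)
  succ n := bot_unique fun x hx =>
    tot_ext K fun p q h => (hx p (by lia) q).trans (map_zero _).symm
  d_mem p n m x hx := by
    by_cases hm : n + 1 = m
    swap
    · rw [Filtration.d_eq_zero _ _ hm]
      exact zero_mem _
    intro i hi j
    by_cases hij : i + j = m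
    · refine (totπ_d K i j n m hm hij x).trans ?_
      have h₁ : totπ K (i - 1) j n x = 0 := hx (i - 1) (by lia) j
      have h₂ : totπ K i (j - 1) n x = 0 := hx i hi (j - 1)
      rw [h₁, h₂, map_zero, map_zero, smul_zero, add_zero]
    · rw [totπ_eq_zero K i j m hij]
      rfl

lemma mem_columnFiltration_succ {p q n : ℕ} (h : p + q = n) {x : (tot K).X n} :
    x ∈ (columnFiltration K).F (p + 1) n ↔
      x ∈ (columnFiltration K).F p n ∧ totπ K p q n x = 0 := by
  refine ⟨fun hx => ⟨fun i hi j => hx i (by lia) j, hx p (by lia) q⟩, fun ⟨hx, h'⟩ i hi j => ?_⟩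
  by_cases hi' : i < p
  · exact hx i hi' j
  obtain rfl : i = p := by lia
  by_cases hj : i + j = n
  · obtain rfl : j = q := by lia
    exact h'
  · rw [totπ_eq_zero K i j n hj]
    rfl

lemma totι_mem_columnFiltration {p q n : ℕ} (h : p + q = n) (y : (K.X p).X q) :
    totι K p q n h y ∈ (columnFiltration K).F p n := fun i hi j =>
  totπ_totι_apply_of_ne K p q i j n h (by lia) y

/-- On `F^p`, the differential of the total complex is, up to a sign, that of the `p`-th column. -/
lemma totπ_d_of_mem {p q n n' : ℕ} (h : n + 1 = n') (hpq : p + q = n') {x : (tot K).X n}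
    (hx : x ∈ (columnFiltration K).F p n) :
    totπ K p q n' ((tot K).d n n' x) =
      (-1 : ℤˣ) ^ p • (K.X p).d (q - 1) q (totπ K p (q - 1) n x) := by
  have h₁ : (K.d (p - 1) p).f q (totπ K (p - 1) q n x) = 0 := by
    obtain rfl | hp := Nat.eq_zero_or_pos p
    · rw [K.shape _ _ (by simp)]
      rfl
    · have : totπ K (p - 1) q n x = 0 := hx (p - 1) (by lia) q
      rw [this, map_zero]
  exact (totπ_d K p q n n' h hpq x).trans (by rw [h₁, zero_add])

lemma col_d_eq_zero (p i j : ℕ) (h : i + 1 ≠ j) (y : (K.X p).X i) : (K.X p).d i j y = 0 :=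
  Filtration.d_eq_zero i j h y

lemma totι_mem_Z (p q : ℕ) (y : (K.X p).X q) (hy : (K.X p).d q (q + 1) y = 0) :
    totι K p q _ rfl y ∈ (columnFiltration K).Z 1 p (p + q) := by
  refine (columnFiltration K).mem_Z.2 ⟨totι_mem_columnFiltration K rfl y, fun m => ?_⟩
  by_cases hm : p + q + 1 = m
  · refine (mem_columnFiltration_succ K (q := q + 1) (by lia)).2
      ⟨(columnFiltration K).d_mem _ _ _ _ (totι_mem_columnFiltration K rfl y), ?_⟩
    rw [totπ_d_of_mem K hm (by lia) (totι_mem_columnFiltration K rfl y)]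
    change _ • (K.X p).d q (q + 1) (totπ K p q (p + q) _) = 0
    rw [totπ_totι_apply, hy, smul_zero]
  · rw [Filtration.d_eq_zero _ _ hm]
    exact zero_mem _

/-- The first page of the spectral sequence of the column filtration consists of the cohomology
groups of the columns. -/
lemma exists_firstPage_iso (p q : ℕ) :
    ∃ e : (K.X p).homology q ≅ ((columnFiltration K).page 1 le_rfl).X (p, q),
      ∀ (z : (K.X p).cycles q) (m : (columnFiltration K).Z 1 p (p + q)),
        (K.X p).iCycles q z = totπ K p q (p + q) m →
          e.hom ((K.X p).homologyπ q z) = (columnFiltration K).toE 1 p (p + q) m := by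
  set Φ := columnFiltration K with hΦ
  refine exists_complex_homology_iso (K.X p) q
    (Q := AddCommGrpCat.of (Φ.E 1 p (p + q)))
    ((totπ K p q (p + q)).hom.comp (Φ.Z 1 p (p + q)).subtype) (Φ.toE 1 p (p + q)) ?_
    (Φ.toE_surjective _ _ _) ?_
  · intro y
    constructor
    · intro hy
      exact ⟨⟨_, totι_mem_Z K p q y (hy _)⟩, totπ_totι_apply K p q _ rfl y⟩
    · rintro ⟨m, rfl⟩ j
      by_cases hj : q + 1 = j
      · subst hj
        have h := ((mem_columnFiltration_succ K (q := q + 1) (by lia)).1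
          ((Φ.mem_Z.1 m.2).2 (p + q + 1))).2
        rw [totπ_d_of_mem K rfl (by lia) (Φ.mem_Z.1 m.2).1, smul_eq_zero_iff_eq] at h
        exact h
      · exact col_d_eq_zero K p q j hj _
  · intro m
    rw [Φ.toE_eq_zero_iff]
    change _ ↔ ∃ j y, (K.X p).d j q y = totπ K p q (p + q) m
    constructor
    · intro hm
      obtain ⟨b, hb, c, hc, h⟩ := Φ.mem_B.1 hm
      have hc' : totπ K p q (p + q) c = 0 := ((mem_columnFiltration_succ K rfl).1 hc).2
      rw [← h, map_add, hc', add_zero]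
      by_cases hn : p + q = 0
      · refine ⟨0, 0, ?_⟩
        refine (map_zero _).trans ?_
        rw [Filtration.d_eq_zero _ _ (by lia), map_zero]
      · refine ⟨q - 1, (-1 : ℤˣ) ^ p • totπ K p (q - 1) (p + q - 1) b, ?_⟩
        have hb' : b ∈ Φ.F p (p + q - 1) := hb
        rw [totπ_d_of_mem K (by lia) rfl hb', Units.smul_def, Units.smul_def, map_zsmul]
    · rintro ⟨j, y, hy⟩
      by_cases hj : j + 1 = q
      · subst hj
        let b : (tot K).X (p + j) := totι K p j _ rfl ((-1 : ℤˣ) ^ p • y)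
        have hb : b ∈ Φ.F p (p + j) := totι_mem_columnFiltration K rfl _
        have := Φ.d_add_mem_B (r := 1) (p := p) (n := p + (j + 1)) (b := b)
          (c := (m : (tot K).X (p + (j + 1))) - (tot K).d (p + j) (p + (j + 1)) b) hb ?_
        · rwa [add_sub_cancel] at this
        · refine (mem_columnFiltration_succ K rfl).2
            ⟨sub_mem (Φ.mem_Z.1 m.2).1 (Φ.d_mem _ _ _ _ hb), ?_⟩
          rw [map_sub, totπ_d_of_mem K (by lia) rfl hb]
          change _ - _ • (K.X p).d j (j + 1) (totπ K p j (p + j) b) = 0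
          rw [totπ_totι_apply, Units.smul_def, Units.smul_def, map_zsmul, smul_smul, hy,
            ← Units.val_mul, ← mul_pow]
          simp
      · rw [col_d_eq_zero K p j q hj] at hy
        exact Φ.mem_B_of_mem ((mem_columnFiltration_succ K rfl).2 ⟨(Φ.mem_Z.1 m.2).1, hy.symm⟩)

/-- The identification of the first page with the cohomology of the columns. -/
def firstPageIso (p q : ℕ) :
    (K.X p).homology q ≅ ((columnFiltration K).page 1 le_rfl).X (p, q) :=
  (exists_firstPage_iso K p q).choose

lemma firstPageIso_hom (p q : ℕ) (z : (K.X p).cycles q)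
    (m : (columnFiltration K).Z 1 p (p + q))
    (h : (K.X p).iCycles q z = totπ K p q (p + q) m) :
    (firstPageIso K p q).hom ((K.X p).homologyπ q z) =
      (columnFiltration K).toE 1 p (p + q) m :=
  (exists_firstPage_iso K p q).choose_spec z m h

/-- The differential of the first page is induced by the horizontal differential. -/
lemma firstPageIso_d (p q : ℕ) :
    (firstPageIso K p q).hom ≫
        ((columnFiltration K).page 1 le_rfl).d (p, q) (p + 1, q) =
      HomologicalComplex.homologyMap (K.d p (p + 1)) q ≫ (firstPageIso K (p + 1) q).hom := by
  set Φ := columnFiltration K with hΦ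
  ext x
  obtain ⟨z, hz⟩ : ∃ z : (K.X p).cycles q, (K.X p).homologyπ q z = x :=
    homologyπ_surjective ((K.X p).sc q) x
  rw [← hz]
  have hy : (K.X p).d q (q + 1) ((K.X p).iCycles q z) = 0 := by
    rw [← ConcreteCategory.comp_apply, (K.X p).iCycles_d]
    rfl
  let m : Φ.Z 1 p (p + q) := ⟨_, totι_mem_Z K p q _ hy⟩
  change (Φ.page 1 le_rfl).d (p, q) (p + 1, q)
      ((firstPageIso K p q).hom ((K.X p).homologyπ q z)) =
    (firstPageIso K (p + 1) q).hom
      (HomologicalComplex.homologyMap (K.d p (p + 1)) q ((K.X p).homologyπ q z))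
  have hrel : (ComplexShape.spectralSequenceNat ⟨1, 1 - 1⟩).Rel (p, q) (p + 1, q) := by
    rw [ComplexShape.spectralSequenceNat_rel_iff]
    dsimp only
    lia
  rw [firstPageIso_hom K p q z m (totπ_totι_apply K p q _ rfl _).symm, Φ.page_d 1 le_rfl hrel]
  have hπ : HomologicalComplex.homologyMap (K.d p (p + 1)) q ((K.X p).homologyπ q z) =
      (K.X (p + 1)).homologyπ q (HomologicalComplex.cyclesMap (K.d p (p + 1)) q z) := by
    rw [← ConcreteCategory.comp_apply, HomologicalComplex.homologyπ_naturality]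
    rfl
  rw [hπ, firstPageIso_hom K (p + 1) q _ (Φ.dZ 1 p (p + q) (p + 1) (p + 1 + q) rfl m)]
  · rfl
  · rw [← ConcreteCategory.comp_apply, HomologicalComplex.cyclesMap_i]
    refine Eq.trans ?_ (totπ_d K (p + 1) q (p + q) (p + 1 + q) (by lia) rfl _).symm
    change _ = (K.d p (p + 1)).f q (totπ K p q (p + q) (totι K p q _ rfl _)) + _ •
      (K.X (p + 1)).d (q - 1) q (totπ K (p + 1) (q - 1) (p + q) (totι K p q _ rfl _))
    rw [totπ_totι_apply, totπ_totι_apply_of_ne _ _ _ _ _ _ _ (by lia), map_zero, smul_zero,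
      add_zero]
    rfl

/-- If the columns are exact in positive degrees, and the complex of the degree `0` cohomology of
the columns is exact in positive degrees, then so is the total complex. -/
lemma isZero_homology_tot
    (hcol : ∀ p q (x : (K.X p).X (q + 1)), (K.X p).d (q + 1) (q + 2) x = 0 →
      ∃ y, (K.X p).d q (q + 1) y = x)
    (hrow : ∀ p (x : (K.X (p + 1)).X 0), (K.X (p + 1)).d 0 1 x = 0 →
      (K.d (p + 1) (p + 2)).f 0 x = 0 →
        ∃ y, (K.X p).d 0 1 y = 0 ∧ (K.d p (p + 1)).f 0 y = x) (n : ℕ) :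
    IsZero ((tot K).homology (n + 1)) := by
  refine isZero_homology_of_exact _ _ fun x hx => ?_
  -- Clear the columns of a cocycle one by one, from left to right.
  have key : ∀ k ≤ n + 1, ∃ y : (tot K).X n,
      x - (tot K).d n (n + 1) y ∈ (columnFiltration K).F k (n + 1) := by
    intro k
    induction k with
    | zero => exact fun _ => ⟨0, fun i hi => absurd hi (Nat.not_lt_zero i)⟩
    | succ k ih =>
      intro hk
      obtain ⟨y, hy⟩ := ih (by lia)
      obtain ⟨q, hq⟩ : ∃ q, k + q = n := ⟨n - k, by lia⟩
      have hd : (tot K).d (n + 1) (n + 2) (x - (tot K).d n (n + 1) y) = 0 := by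
        rw [map_sub, Filtration.d_d, hx, sub_zero]
      have hu := totπ_d_of_mem K (q := q + 2) rfl (by lia) hy
      rw [hd, map_zero, eq_comm, smul_eq_zero_iff_eq] at hu
      obtain ⟨v, hv⟩ := hcol k q _ hu
      have hι := totι_mem_columnFiltration K hq ((-1 : ℤˣ) ^ k • v)
      refine ⟨y + totι K k q n hq ((-1 : ℤˣ) ^ k • v), ?_⟩
      rw [map_add, ← sub_sub]
      refine (mem_columnFiltration_succ K (q := q + 1) (by lia)).2
        ⟨sub_mem hy ((columnFiltration K).d_mem _ _ _ _ hι), ?_⟩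
      rw [map_sub, totπ_d_of_mem K rfl (by lia) hι]
      change _ - _ • (K.X k).d q (q + 1) (totπ K k q n _) = 0
      rw [totπ_totι_apply, Units.smul_def, Units.smul_def, map_zsmul, smul_smul, hv,
        ← Units.val_mul, ← mul_pow]
      simp
  obtain ⟨y, hy⟩ := key (n + 1) le_rfl
  have hd : (tot K).d (n + 1) (n + 2) (x - (tot K).d n (n + 1) y) = 0 := by
    rw [map_sub, Filtration.d_d, hx, sub_zero]
  have h₁ := totπ_d_of_mem K (q := 1) rfl rfl hy
  rw [hd, map_zero, eq_comm, smul_eq_zero_iff_eq] at h₁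
  have h₂ := totπ_d K (n + 2) 0 (n + 1) (n + 2) rfl rfl (x - (tot K).d n (n + 1) y)
  rw [hd, map_zero, col_d_eq_zero K (n + 2) (0 - 1) 0 (by lia), smul_zero, add_zero, eq_comm] at h₂
  obtain ⟨v, hv, hv'⟩ := hrow n _ h₁ h₂
  refine ⟨n, y + totι K n 0 n rfl v, ?_⟩
  rw [map_add, ← eq_sub_iff_add_eq', eq_comm]
  refine tot_ext K fun i j hij => ?_
  have hd' := totπ_d K i j n (n + 1) rfl hij (totι K n 0 n rfl v)
  refine Eq.trans ?_ hd'.symm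
  obtain hi | rfl : i < n + 1 ∨ i = n + 1 := by lia
  · have h₃ : totπ K i j (n + 1) (x - (tot K).d n (n + 1) y) = 0 := hy i hi j
    rw [h₃, totπ_totι_apply_of_ne K n 0 (i - 1) j n rfl (by lia), map_zero, zero_add]
    by_cases hi' : i = n
    · subst hi'
      obtain rfl : j = 1 := by lia
      change 0 = _ • (K.X i).d 0 1 (totπ K i 0 i _)
      rw [totπ_totι_apply, hv, smul_zero]
    · rw [totπ_totι_apply_of_ne K n 0 i (j - 1) n rfl (by lia), map_zero, smul_zero]
  · obtain rfl : j = 0 := by lia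
    rw [totπ_totι_apply_of_ne K n 0 (n + 1) (0 - 1) n rfl (by lia), map_zero, smul_zero, add_zero]
    change _ = (K.d n (n + 1)).f 0 (totπ K n 0 n _)
    rw [totπ_totι_apply, hv']

end TotalComplex

/-! ### Cohomology in degree zero -/

section DegreeZero

variable {A : Type*} [Category* A] (Φ : A ⥤ CochainComplex AddCommGrpCat.{w} ℕ)
  {Γ : A ⥤ AddCommGrpCat.{w}}

/-- If `Γ P` is, naturally in `P`, the kernel of the first differential of `Φ P`, then it is the
cohomology of `Φ P` in degree zero. -/
lemma nonempty_iso_homology_zero (α : ∀ P, Γ.obj P ⟶ (Φ.obj P).X 0)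
    (nat : ∀ {P Q} (f : P ⟶ Q), Γ.map f ≫ α Q = α P ≫ (Φ.map f).f 0)
    (inj : ∀ P, Function.Injective (α P))
    (d_α : ∀ P x, (Φ.obj P).d 0 1 (α P x) = 0)
    (exact : ∀ P (y : (Φ.obj P).X 0), (Φ.obj P).d 0 1 y = 0 → ∃ x, α P x = y) :
    Nonempty (Γ ≅ Φ ⋙ HomologicalComplex.homologyFunctor _ _ 0) := by
  let l : ∀ P, Γ.obj P ⟶ (Φ.obj P).cycles 0 := fun P =>
    (Φ.obj P).liftCycles (α P) 1 (by simp) (by ext x; exact d_α P x)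
  have hl : ∀ P x, (Φ.obj P).iCycles 0 (l P x) = α P x := fun P x => by
    rw [← ConcreteCategory.comp_apply, HomologicalComplex.liftCycles_i]
  have lnat : ∀ {P Q} (f : P ⟶ Q), Γ.map f ≫ l Q = l P ≫ HomologicalComplex.cyclesMap (Φ.map f) 0 :=
    fun {P Q} f => by
      rw [← cancel_mono ((Φ.obj Q).iCycles 0), Category.assoc, Category.assoc,
        HomologicalComplex.liftCycles_i, HomologicalComplex.cyclesMap_i, ← Category.assoc,
        HomologicalComplex.liftCycles_i, nat]
  let β : Γ ⟶ Φ ⋙ HomologicalComplex.homologyFunctor _ _ 0 :=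
    { app P := l P ≫ (Φ.obj P).homologyπ 0
      naturality P Q f := by
        change _ = (l P ≫ (Φ.obj P).homologyπ 0) ≫ HomologicalComplex.homologyMap (Φ.map f) 0
        have h : Γ.map f ≫ l Q ≫ (Φ.obj Q).homologyπ 0 =
            (l P ≫ (Φ.obj P).homologyπ 0) ≫ HomologicalComplex.homologyMap (Φ.map f) 0 := by
          rw [Category.assoc, HomologicalComplex.homologyπ_naturality, ← Category.assoc,
            ← Category.assoc, lnat]
        exact h }
  have : ∀ P, IsIso (β.app P) := fun P => by
    rw [ConcreteCategory.isIso_iff_bijective]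
    constructor
    · refine (injective_iff_map_eq_zero (β.app P).hom).2 fun x hx => ?_
      obtain ⟨j, y, hy⟩ := (complex_homologyπ_eq_zero_iff (Φ.obj P) 0 (l P x)).1 hx
      rw [Filtration.d_eq_zero _ _ (by lia), hl] at hy
      exact inj P (hy.symm.trans (map_zero _).symm)
    · intro y
      obtain ⟨z, hz⟩ : ∃ z : (Φ.obj P).cycles 0, (Φ.obj P).homologyπ 0 z = y :=
        homologyπ_surjective ((Φ.obj P).sc 0) y
      obtain ⟨x, hx⟩ := exact P ((Φ.obj P).iCycles 0 z) (by
        rw [← ConcreteCategory.comp_apply, HomologicalComplex.iCycles_d]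
        rfl)
      refine ⟨x, Eq.trans (congrArg ((Φ.obj P).homologyπ 0) (iCycles_injective _ ?_)) hz⟩
      exact (hl P x).trans hx
  exact ⟨NatIso.ofComponents (fun P => asIso (β.app P)) (fun f => β.naturality f)⟩

end DegreeZero

/-! ### The Godement complex of a pair `(X, P)` -/

section GodementComplex

lemma sum_zsmul_apply {A B : AddCommGrpCat.{w}} {n : ℕ} (c : Fin n → ℤ) (f : Fin n → (A ⟶ B))
    (x : A) : (∑ i, c i • f i) x = ∑ i, c i • f i x := by
  change AddCommGrpCat.homAddEquiv (∑ i, c i • f i) x = ∑ i, c i • AddCommGrpCat.homAddEquiv (f i) x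
  simp only [map_sum, map_zsmul, AddMonoidHom.finsetSum_apply, AddMonoidHom.zsmul_apply]

lemma SemiCosimplicial.asFunctor_d {A : Type*} [Category* A] {B : Type*} [Category* B]
    [Preadditive B] (K : SemiCosimplicial (A ⥤ B)) (a : A) (n : ℕ) :
    (K.complex.asFunctor.obj a).d n (n + 1) =
      ∑ i : Fin (n + 2), (-1 : ℤ) ^ (i : ℕ) • (K.δ i).app a := by
  have h : K.complex.d n (n + 1) = K.d n := CochainComplex.of_d K.X K.d n
  refine (congrArg (fun k : K.X n ⟶ K.X (n + 1) => k.app a) h).trans ?_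
  exact NatTrans.app_sum _ _ _

/-- The map on global sections induced by a morphism of `AbSpace`. -/
abbrev globalMap {Y Z : AbSpace.{w}} (f : Y ⟶ Z) :
    Z.presheaf.obj (op ⊤) ⟶ Y.presheaf.obj (op ⊤) :=
  f.c.app (op ⊤)

lemma globalMap_comp {Y Z W : AbSpace.{w}} (f : Y ⟶ Z) (g : Z ⟶ W)
    (x : W.presheaf.obj (op ⊤)) : globalMap (f ≫ g) x = globalMap f (globalMap g x) := rfl

/-- The differential of the complex of global sections of the Godement resolution. -/
def godementD (Y : AbSpace.{w}) (q : ℕ) :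
    ((godementIter (q + 1)).obj Y).presheaf.obj (op ⊤) ⟶
      ((godementIter (q + 2)).obj Y).presheaf.obj (op ⊤) :=
  ∑ i : Fin (q + 2), (-1 : ℤ) ^ (i : ℕ) • globalMap ((godementFace (q + 1) i).app Y)

lemma godementComplex_d (Y : AbSpace.{w}) (q : ℕ) :
    (godementComplex.obj (op Y)).d q (q + 1) = godementD Y q :=
  godementCosimplicial.{w}.asFunctor_d (op Y) q

lemma godementD_apply (Y : AbSpace.{w}) (q : ℕ)
    (x : ((godementIter (q + 1)).obj Y).presheaf.obj (op ⊤)) :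
    godementD Y q x =
      ∑ i : Fin (q + 2), (-1 : ℤ) ^ (i : ℕ) • globalMap ((godementFace (q + 1) i).app Y) x := by
  exact sum_zsmul_apply _ _ x

variable {Y : AbSpace.{w}} (r : Y ⟶ godement.obj Y)

/-- The maps `C⁰ ⋯ C⁰(C⁰(P)) ⟶ C⁰ ⋯ C⁰(P)` (in `AbSpace` the arrows are reversed) induced
by `C⁰(P) ⟶ P`. -/
def iterRetract : ∀ n : ℕ, (godementIter n).obj Y ⟶ (godementIter (n + 1)).obj Y
  | 0 => r
  | n + 1 => godement.map (iterRetract n)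

lemma iterRetract_last (hr : r ≫ godementUnit.app Y = 𝟙 Y) (n : ℕ) :
    iterRetract r n ≫ (godementFace n (Fin.last n)).app Y = 𝟙 _ := by
  induction n with
  | zero => exact hr
  | succ n ih =>
    refine (godement.map_comp (iterRetract r n) ((godementFace n (Fin.last n)).app Y)).symm.trans ?_
    rw [ih]
    exact godement.map_id _

lemma iterRetract_castSucc (n : ℕ) (i : Fin (n + 1)) :
    iterRetract r (n + 1) ≫ (godementFace (n + 1) i.castSucc).app Y =
      (godementFace n i).app Y ≫ iterRetract r n := by
  induction n with
  | zero =>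
    obtain rfl : i = 0 := Fin.fin_one_eq_zero i
    exact godementUnit.naturality (iterRetract r 0)
  | succ n ih =>
    induction i using Fin.cases with
    | zero => exact godementUnit.naturality (iterRetract r (n + 1))
    | succ i =>
      rw [← Fin.succ_castSucc]
      refine (godement.map_comp (iterRetract r (n + 1))
        ((godementFace (n + 1) i.castSucc).app Y)).symm.trans ?_
      rw [ih]
      exact godement.map_comp _ _

/-- If the embedding `P ⟶ C⁰(P)` has a retraction, then the complex of global sections
of the Godement resolution of `P` is exact in positive degrees. -/
lemma exists_godementComplex_d_eq (hr : r ≫ godementUnit.app Y = 𝟙 Y) (q : ℕ)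
    (x : (godementComplex.obj (op Y)).X (q + 1))
    (hx : (godementComplex.obj (op Y)).d (q + 1) (q + 2) x = 0) :
    ∃ y, (godementComplex.obj (op Y)).d q (q + 1) y = x := by
  rw [godementComplex_d] at hx ⊢
  revert x
  change ∀ x : ((godementIter (q + 2)).obj Y).presheaf.obj (op ⊤), godementD Y (q + 1) x = 0 →
    ∃ y : ((godementIter (q + 1)).obj Y).presheaf.obj (op ⊤), godementD Y q y = x
  intro x hx
  rw [godementD_apply, Fin.sum_univ_castSucc] at hx
  have h := congrArg (globalMap (iterRetract r (q + 2))) hx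
  rw [map_zero (globalMap (iterRetract r (q + 2))).hom, map_add, map_sum, map_zsmul] at h
  have h₁ : globalMap (iterRetract r (q + 2))
      (globalMap ((godementFace (q + 2) (Fin.last _)).app Y) x) = x := by
    rw [← globalMap_comp, iterRetract_last r hr]
    rfl
  have h₂ : ∀ i : Fin (q + 2), globalMap (iterRetract r (q + 2))
      (globalMap ((godementFace (q + 2) i.castSucc).app Y) x) =
      globalMap ((godementFace (q + 1) i).app Y) (globalMap (iterRetract r (q + 1)) x) :=
    fun i => by
      rw [← globalMap_comp, iterRetract_castSucc]
      rfl
  have h₃ : godementD Y q (globalMap (iterRetract r (q + 1)) x) + (-1 : ℤ) ^ (q + 2) • x = 0 := by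
    rw [godementD_apply]
    refine Eq.trans ?_ h
    refine congrArg₂ (· + ·) (Finset.sum_congr rfl fun i _ => ?_) ?_
    · rw [map_zsmul]
      exact congrArg _ (h₂ i).symm
    · exact congrArg _ h₁.symm
  refine ⟨(-1 : ℤ) ^ (q + 1) • globalMap (iterRetract r (q + 1)) x, ?_⟩
  rw [map_zsmul, eq_neg_of_add_eq_zero_left h₃, smul_neg, smul_smul, ← pow_add, ← neg_smul,
    show q + 1 + (q + 2) = 2 * (q + 1) + 1 by lia, pow_succ, pow_mul]
  simp

end GodementComplex

/-! ### Discontinuous sections of presheaves on a fixed space -/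

section FixedSpace

open TopCat.Presheaf

variable {X : TopCat.{w}}

/-- The functor `P ↦ C⁰(P)` on presheaves on `X`. -/
def discFunctor (X : TopCat.{w}) : X.Presheaf AddCommGrpCat.{w} ⥤ X.Presheaf AddCommGrpCat.{w} where
  obj P := discSections P
  map {P Q} f :=
    { app U := AddCommGrpCat.ofHom
        { toFun s x := (stalkFunctor _ x.1).map f (s x)
          map_zero' := funext fun x => map_zero ((stalkFunctor _ x.1).map f).hom
          map_add' s t := funext fun x => map_add ((stalkFunctor _ x.1).map f).hom _ _ } }
  map_id P := by
    ext U s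
    funext x
    exact congrArg (fun k => k.hom (s x)) ((stalkFunctor _ x.1).map_id P)
  map_comp f g := by
    ext U s
    funext x
    exact congrArg (fun k => k.hom (s x)) ((stalkFunctor _ x.1).map_comp f g)

/-- The embedding `P ⟶ C⁰(P)`. -/
def discUnit (P : X.Presheaf AddCommGrpCat.{w}) : P ⟶ discSections P :=
  (godementUnit.app (⟨X, P⟩ : AbSpace.{w})).c

/-- The functor `P ↦ (X, P)`. -/
def pairOn (X : TopCat.{w}) : X.Presheaf AddCommGrpCat.{w} ⥤ AbSpace.{w}ᵒᵖ where
  obj P := op ⟨X, P⟩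
  map {P Q} f := Quiver.Hom.op (X := (⟨X, Q⟩ : AbSpace.{w})) (Y := (⟨X, P⟩ : AbSpace.{w}))
    { base := 𝟙 _
      c := f }
  map_id P := by
    apply Quiver.Hom.unop_inj
    refine PresheafedSpace.hext _ _ rfl (heq_of_eq (NatTrans.ext (funext fun U => ?_)))
    rfl
  map_comp f g := by
    apply Quiver.Hom.unop_inj
    refine PresheafedSpace.hext _ _ rfl (heq_of_eq (NatTrans.ext (funext fun U => ?_)))
    rfl

lemma stalkMap_pairOn {P Q : X.Presheaf AddCommGrpCat.{w}} (f : P ⟶ Q) (x : X) :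
    PresheafedSpace.Hom.stalkMap ((pairOn X).map f).unop x = (stalkFunctor _ x).map f := by
  refine stalk_hom_ext _ fun U hx => ?_
  refine (PresheafedSpace.stalkMap_germ ((pairOn X).map f).unop U x hx).trans ?_
  exact (stalkFunctor_map_germ U x hx f).symm

/-- The compatibility of `P ↦ (X, P)` with `C⁰`. -/
def pairOnGodement (X : TopCat.{w}) : pairOn X ⋙ godement.op ≅ discFunctor X ⋙ pairOn X :=
  NatIso.ofComponents (fun P => Iso.refl (op (⟨X, discSections P⟩ : AbSpace.{w}))) (fun f => by
    refine (Category.comp_id _).trans (Eq.trans ?_ (Category.id_comp _).symm)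
    apply Quiver.Hom.unop_inj
    refine PresheafedSpace.hext _ _ rfl (heq_of_eq (NatTrans.ext (funext fun U => ?_)))
    ext s
    funext x
    exact congrArg (fun k => k.hom (s x)) (stalkMap_pairOn f x.1))

/-- The iterates of `C⁰` on presheaves on `X`. -/
def discIter (X : TopCat.{w}) : ℕ → (X.Presheaf AddCommGrpCat.{w} ⥤ X.Presheaf AddCommGrpCat.{w})
  | 0 => 𝟭 _
  | n + 1 => discIter X n ⋙ discFunctor X

/-- The compatibility of `P ↦ (X, P)` with the iterates of `C⁰`. -/
def pairOnGodementIter (X : TopCat.{w}) :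
    ∀ n, pairOn X ⋙ (godementIter n).op ≅ discIter X n ⋙ pairOn X
  | 0 => NatIso.ofComponents (fun P => Iso.refl (op (⟨X, P⟩ : AbSpace.{w}))) (fun _ =>
      (Category.comp_id _).trans (Category.id_comp _).symm)
  | n + 1 => Functor.isoWhiskerRight (pairOnGodementIter X n) godement.op ≪≫
      Functor.isoWhiskerLeft (discIter X n) (pairOnGodement X)

end FixedSpace

/-! ### Exactness of the Godement complex -/

section GodementExact

open TopCat.Presheaf

variable {X : TopCat.{w}} {P Q R : X.Presheaf AddCommGrpCat.{w}}

/-- A sequence of presheaves `0 ⟶ P ⟶ Q ⟶ R ⟶ 0` which is exact on sections, except that the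
sections of `R` lift to `Q` only locally. -/
structure LocallyExact (f : P ⟶ Q) (g : Q ⟶ R) : Prop where
  injective (U : Opens X) : Function.Injective (f.app (op U))
  exact (U : Opens X) (s : Q.obj (op U)) : g.app (op U) s = 0 ↔ ∃ t, f.app (op U) t = s
  surjective (U : Opens X) (s : R.obj (op U)) (x : X) (hx : x ∈ U) :
    ∃ (V : Opens X) (h : V ≤ U), x ∈ V ∧ ∃ t, g.app (op V) t = R.map (homOfLE h).op s

namespace LocallyExact

variable {f : P ⟶ Q} {g : Q ⟶ R} (h : LocallyExact f g) (x : X)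

include h

lemma stalk_injective : Function.Injective ((stalkFunctor _ x).map f) :=
  stalkFunctor_map_injective_of_app_injective (fun U => h.injective U) x

lemma stalk_exact (s : Q.stalk x) :
    (stalkFunctor _ x).map g s = 0 ↔ ∃ t, (stalkFunctor _ x).map f t = s := by
  constructor
  · intro hs
    obtain ⟨U, hx, s, rfl⟩ := Q.exists_germ_eq s
    rw [stalkFunctor_map_germ_apply] at hs
    obtain ⟨V, hV, i, _, h'⟩ := R.germ_eq x hx hx _ _ (hs.trans (map_zero (R.germ U x hx).hom).symm)
    obtain ⟨t, ht⟩ := (h.exact V (Q.map i.op s)).1 (by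
      rw [← ConcreteCategory.comp_apply, g.naturality]
      exact h'.trans (map_zero (R.map _).hom))
    refine ⟨P.germ V x hV t, ?_⟩
    rw [stalkFunctor_map_germ_apply, ht, germ_res_apply]
  · rintro ⟨t, rfl⟩
    obtain ⟨U, hx, t, rfl⟩ := P.exists_germ_eq t
    rw [stalkFunctor_map_germ_apply, stalkFunctor_map_germ_apply, (h.exact U _).2 ⟨t, rfl⟩]
    exact map_zero (R.germ U x hx).hom

lemma stalk_surjective : Function.Surjective ((stalkFunctor _ x).map g) := by
  intro s
  obtain ⟨U, hx, s, rfl⟩ := R.exists_germ_eq s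
  obtain ⟨V, i, hV, t, ht⟩ := h.surjective U s x hx
  refine ⟨Q.germ V x hV t, ?_⟩
  rw [stalkFunctor_map_germ_apply, ht, germ_res_apply]

lemma disc_surjective (U : Opens X) :
    Function.Surjective (((discFunctor X).map g).app (op U)) := by
  intro s
  choose t ht using fun y : U => h.stalk_surjective y.1 (s y)
  exact ⟨t, funext ht⟩

lemma disc : LocallyExact ((discFunctor X).map f) ((discFunctor X).map g) where
  injective U s t hst := funext fun y => h.stalk_injective y.1 (congrFun hst y)
  exact U s := by
    refine ⟨fun hs => ?_, ?_⟩
    · choose t ht using fun y : U => (h.stalk_exact y.1 (s y)).1 (congrFun hs y)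
      exact ⟨t, funext ht⟩
    · rintro ⟨t, rfl⟩
      exact funext fun y => (h.stalk_exact y.1 _).2 ⟨t y, rfl⟩
  surjective U s y hy := ⟨U, le_rfl, hy, h.disc_surjective U _⟩

lemma iter (n : ℕ) : LocallyExact ((discIter X n).map f) ((discIter X n).map g) := by
  induction n with
  | zero => exact h
  | succ n ih => exact ih.disc

end LocallyExact

/-- The Godement complex of presheaves on `X`. -/
abbrev godementOn (X : TopCat.{w}) :
    X.Presheaf AddCommGrpCat.{w} ⥤ CochainComplex AddCommGrpCat.{w} ℕ :=
  pairOn X ⋙ godementComplex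

/-- The terms of the Godement complex are global sections of iterates of `C⁰`. -/
def godementOnX (P : X.Presheaf AddCommGrpCat.{w}) (q : ℕ) :
    ((godementOn X).obj P).X q ≃+ ((discIter X (q + 1)).obj P).obj (op ⊤) :=
  (PresheafedSpace.Γ.mapIso ((pairOnGodementIter X (q + 1)).app P)).addCommGroupIsoToAddEquiv

lemma godementOnX_map (f : P ⟶ Q) (q : ℕ) (x : ((godementOn X).obj P).X q) :
    godementOnX Q q (((godementOn X).map f).f q x) =
      ((discIter X (q + 1)).map f).app (op ⊤) (godementOnX P q x) := by
  have := congrArg PresheafedSpace.Γ.map ((pairOnGodementIter X (q + 1)).hom.naturality f)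
  rw [Functor.map_comp, Functor.map_comp] at this
  exact ConcreteCategory.congr_hom this x

lemma disc_map_zero (f : P ⟶ Q) (hf : ∀ U s, f.app U s = 0) (U) (s) :
    ((discFunctor X).map f).app U s = 0 := by
  funext x
  obtain ⟨V, hx, t, ht⟩ := P.exists_germ_eq (s x)
  change (stalkFunctor _ x.1).map f (s x) = 0
  rw [← ht, stalkFunctor_map_germ_apply, hf]
  exact map_zero (Q.germ V x.1 hx).hom

lemma discIter_map_zero (f : P ⟶ Q) (hf : ∀ U s, f.app U s = 0) (n : ℕ) :
    ∀ U s, ((discIter X n).map f).app U s = 0 := by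
  induction n with
  | zero => exact hf
  | succ n ih => exact disc_map_zero _ ih

lemma godementOn_map_zero (f : P ⟶ Q) (hf : ∀ U s, f.app U s = 0) (q : ℕ)
    (x : ((godementOn X).obj P).X q) : ((godementOn X).map f).f q x = 0 := by
  apply (godementOnX Q q).injective
  rw [godementOnX_map, discIter_map_zero f hf, map_zero]

namespace LocallyExact

variable {f : P ⟶ Q} {g : Q ⟶ R} (h : LocallyExact f g) (q : ℕ)

include h

lemma godement_injective : Function.Injective (((godementOn X).map f).f q) := fun x y hxy => by
  apply (godementOnX P q).injective
  apply (h.iter (q + 1)).injective ⊤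
  rw [← godementOnX_map, ← godementOnX_map, hxy]

lemma godement_exact (x : ((godementOn X).obj Q).X q) :
    ((godementOn X).map g).f q x = 0 ↔ ∃ y, ((godementOn X).map f).f q y = x := by
  rw [← (godementOnX R q).map_eq_zero_iff, godementOnX_map, (h.iter (q + 1)).exact ⊤]
  constructor
  · rintro ⟨t, ht⟩
    refine ⟨(godementOnX P q).symm t, (godementOnX Q q).injective ?_⟩
    rw [godementOnX_map, AddEquiv.apply_symm_apply, ht]
  · rintro ⟨y, rfl⟩
    exact ⟨_, (godementOnX_map f q y).symm⟩

lemma godement_surjective : Function.Surjective (((godementOn X).map g).f q) := fun x => by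
  obtain ⟨(t : ((discIter X (q + 1)).obj Q).obj (op ⊤)), ht⟩ :=
    (h.iter q).disc_surjective ⊤ (godementOnX R q x)
  refine ⟨(godementOnX Q q).symm t, (godementOnX R q).injective ?_⟩
  rw [godementOnX_map, AddEquiv.apply_symm_apply]
  exact ht

end LocallyExact

end GodementExact

/-! ### Acyclicity of flasque sheaves and of injective sheaves -/

section Acyclic

open TopCat.Presheaf

variable {X : TopCat.{w}}

lemma discSections_isSheaf (P : X.Presheaf AddCommGrpCat.{w}) : (discSections P).IsSheaf := by
  rw [TopCat.Presheaf.isSheaf_iff_isSheaf_comp (forget AddCommGrpCat.{w})]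
  exact TopCat.Presheaf.toTypes_isSheaf X (fun x => P.stalk x)

/-- The sheaf `C⁰(P)`. -/
def discSheaf (P : X.Presheaf AddCommGrpCat.{w}) : TopCat.Sheaf AddCommGrpCat.{w} X :=
  ⟨discSections P, discSections_isSheaf P⟩

lemma discSections_map_surjective (P : X.Presheaf AddCommGrpCat.{w}) {U V : (Opens X)ᵒᵖ}
    (i : U ⟶ V) : Function.Surjective ((discSections P).map i) := by
  classical
  intro s
  refine ⟨fun x => if h : x.1 ∈ V.unop then s ⟨x.1, h⟩ else 0, funext fun x => ?_⟩
  exact dif_pos x.2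

instance (P : X.Presheaf AddCommGrpCat.{w}) : (discSheaf P).IsFlasque where
  epi i := (AddCommGrpCat.epi_iff_surjective _).2 (discSections_map_surjective P i)

/-- Evaluation at `x` of germs of discontinuous sections. -/
def discEval (P : X.Presheaf AddCommGrpCat.{w}) (x : X) : (discSections P).stalk x ⟶ P.stalk x :=
  colimit.desc ((OpenNhds.inclusion x).op ⋙ discSections P)
    { pt := P.stalk x
      ι :=
        { app U := AddCommGrpCat.ofHom
            { toFun (s : ∀ y : U.unop.1, P.stalk y.1) := s ⟨x, U.unop.2⟩
              map_zero' := rfl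
              map_add' _ _ := rfl } } }

lemma discEval_germ (P : X.Presheaf AddCommGrpCat.{w}) (U : Opens X) (x : X) (hx : x ∈ U)
    (s : (discSections P).obj (op U)) :
    discEval P x ((discSections P).germ U x hx s) = s ⟨x, hx⟩ := by
  have := colimit.ι_desc (F := (OpenNhds.inclusion x).op ⋙ discSections P)
    { pt := P.stalk x
      ι :=
        { app U := AddCommGrpCat.ofHom
            { toFun (s : ∀ y : U.unop.1, P.stalk y.1) := s ⟨x, U.unop.2⟩
              map_zero' := rfl
              map_add' _ _ := rfl } } } (op ⟨U, hx⟩)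
  exact ConcreteCategory.congr_hom this s

/-- The retraction `C⁰(C⁰(P)) ⟶ C⁰(P)` of the embedding. -/
def discRetract (P : X.Presheaf AddCommGrpCat.{w}) :
    discSections (discSections P) ⟶ discSections P where
  app U := AddCommGrpCat.ofHom
    { toFun s x := discEval P x.1 (s x)
      map_zero' := funext fun x => map_zero (discEval P x.1).hom
      map_add' s t := funext fun x => map_add (discEval P x.1).hom _ _ }

lemma godementOn_exact_of_retract {P : X.Presheaf AddCommGrpCat.{w}} (r : discSections P ⟶ P)
    (hr : discUnit P ≫ r = 𝟙 P) (q : ℕ) (x : ((godementOn X).obj P).X (q + 1))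
    (hx : ((godementOn X).obj P).d (q + 1) (q + 2) x = 0) :
    ∃ y, ((godementOn X).obj P).d q (q + 1) y = x := by
  refine exists_godementComplex_d_eq (Y := ⟨X, P⟩) ((pairOn X).map r).unop ?_ q x hx
  refine PresheafedSpace.hext _ _ rfl (heq_of_eq ?_)
  exact hr

lemma godementOn_disc_exact (P : X.Presheaf AddCommGrpCat.{w}) (q : ℕ)
    (x : ((godementOn X).obj (discSections P)).X (q + 1))
    (hx : ((godementOn X).obj (discSections P)).d (q + 1) (q + 2) x = 0) :
    ∃ y, ((godementOn X).obj (discSections P)).d q (q + 1) y = x := by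
  refine godementOn_exact_of_retract (discRetract P) ?_ q x hx
  refine NatTrans.ext (funext fun U => ?_)
  ext s
  funext y
  exact discEval_germ P U.unop y.1 y.2 s

lemma discUnit_injective (P : TopCat.Sheaf AddCommGrpCat.{w} X) (U : Opens X) :
    Function.Injective ((discUnit P.obj).app (op U)) := fun s t h =>
  section_ext P U s t fun x hx => congrFun h ⟨x, hx⟩

lemma godementOn_map_discUnit {P Q : X.Presheaf AddCommGrpCat.{w}} (f : P ⟶ Q)
    (s : P.obj (op ⊤)) :
    ((godementOn X).map f).f 0 ((discUnit P).app (op ⊤) s) =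
      (discUnit Q).app (op ⊤) (f.app (op ⊤) s) :=
  funext fun x : (⊤ : Opens X) =>
    (congrArg (fun k => k.hom (P.germ ⊤ x.1 trivial s)) (stalkMap_pairOn f x.1)).trans
      (stalkFunctor_map_germ_apply ⊤ x.1 trivial f s)

/-- The sections of a sheaf `P` form the kernel of the first differential of the Godement complex:
if the germ at each point `x` of a discontinuous section `s` is that of the family of germs of a
section representing `s x`, then `s` is locally, hence globally, a family of germs. -/
lemma exists_discUnit_eq (P : TopCat.Sheaf AddCommGrpCat.{w} X)
    (s : ((godementOn X).obj P.obj).X 0) :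
    ((godementOn X).obj P.obj).d 0 1 s = 0 ↔ ∃ t, (discUnit P.obj).app (op ⊤) t = s := by
  let Y : AbSpace.{w} := ⟨X, P.obj⟩
  have e₀ : ((godementOn X).obj P.obj).d 0 1 = godementD Y 0 := godementComplex_d Y 0
  rw [e₀]
  revert s
  change ∀ s : (discSections P.obj).obj (op ⊤), godementD Y 0 s = 0 ↔
    ∃ t, (discUnit P.obj).app (op ⊤) t = s
  intro s
  have e : godementD Y 0 s = 0 ↔ ∀ x : X, germ (discSections P.obj) ⊤ x trivial s =
      (stalkFunctor _ x).map (discUnit P.obj) (s ⟨x, trivial⟩) := by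
    have hd : godementD Y 0 s = globalMap (godementUnit.app (godement.obj Y)) s -
        globalMap (godement.map (godementUnit.app Y)) s := by
      refine (godementD_apply Y 0 s).trans ((Fin.sum_univ_two _).trans ?_)
      change (-1 : ℤ) ^ 0 • globalMap (godementUnit.app (godement.obj Y)) s +
        (-1 : ℤ) ^ 1 • globalMap (godement.map (godementUnit.app Y)) s = _
      rw [pow_zero, pow_one, one_smul, neg_one_zsmul, sub_eq_add_neg]
    refine (Iff.of_eq (congrArg (· = 0) hd)).trans (sub_eq_zero.trans ?_)
    constructor
    · intro h x
      exact (congrFun h ⟨x, trivial⟩).trans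
        (congrArg (fun k => k.hom (s ⟨x, trivial⟩)) (stalkMap_pairOn (discUnit P.obj) x))
    · intro h
      funext x
      exact (h x.1).trans
        (congrArg (fun k => k.hom (s x)) (stalkMap_pairOn (discUnit P.obj) x.1)).symm
  rw [e]
  constructor
  · intro h
    have loc : ∀ x : X, ∃ V : Opens X, x ∈ V ∧ ∃ t : P.obj.obj (op V),
        ∀ y (hy : y ∈ V), germ P.obj V y hy t = s ⟨y, trivial⟩ := fun x => by
      obtain ⟨V, hx, t, ht⟩ := exists_germ_eq P.obj (s ⟨x, trivial⟩)
      have h' := h x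
      rw [← ht, stalkFunctor_map_germ_apply] at h'
      obtain ⟨W, hW, i₁, i₂, h''⟩ := germ_eq (discSections P.obj) (U := ⊤) (V := V) x trivial
        hx _ _ h'
      refine ⟨W, hW, P.obj.map i₂.op t, fun y hy => ?_⟩
      rw [germ_res_apply]
      exact (congrFun h'' ⟨y, hy⟩).symm
    choose V hV t ht using loc
    obtain ⟨u, hu, -⟩ := P.existsUnique_gluing' V ⊤ (fun x => homOfLE le_top)
      (fun x _ => Opens.mem_iSup.2 ⟨x, hV x⟩) t (fun x y => by
        refine section_ext P _ _ _ fun z hz => ?_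
        rw [germ_res_apply, germ_res_apply, ht, ht])
    refine ⟨u, funext fun x => ?_⟩
    have := congrArg (germ P.obj (V x.1) x.1 (hV x.1)) (hu x.1)
    rw [germ_res_apply, ht] at this
    exact this
  · rintro ⟨t, rfl⟩ x
    exact (stalkFunctor_map_germ_apply (F := P.obj) (G := discSections P.obj) ⊤ x trivial
      (discUnit P.obj) t).symm

lemma locallyExact_of_shortExact {S : ShortComplex (TopCat.Sheaf AddCommGrpCat.{w} X)}
    (hS : S.ShortExact) : LocallyExact S.f.hom S.g.hom where
  injective U := by
    have := hS.mono_f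
    have : Mono ((TopCat.Sheaf.forget _ X).map S.f) := inferInstance
    have : Mono S.f.hom := this
    exact (AddCommGrpCat.mono_iff_injective _).1 (inferInstanceAs (Mono (S.f.hom.app (op U))))
  exact U s := by
    refine ⟨fun h => TopCat.Sheaf.sections_exact_of_left_exact hS.exact hS.mono_f s h, ?_⟩
    rintro ⟨t, rfl⟩
    have := congrArg (fun k => k.hom.app (op U) t) S.zero
    exact this
  surjective U s x hx := by
    have := (TopCat.Sheaf.isLocallySurjective_iff_epi S.g).2 hS.epi_g
    obtain ⟨V, i, ⟨t, ht⟩, hV⟩ := (TopCat.Presheaf.isLocallySurjective_iff S.g.hom).1 this U s x hx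
    exact ⟨V, i, hV, t, ht⟩

/-- The embedding of a sheaf `P` in `C⁰(P)`. -/
def discUnitSheaf (P : TopCat.Sheaf AddCommGrpCat.{w} X) : P ⟶ discSheaf P.obj := ⟨discUnit P.obj⟩

instance (P : TopCat.Sheaf AddCommGrpCat.{w} X) : Mono (discUnitSheaf P) := by
  have : ∀ U, Mono ((discUnit P.obj).app U) := fun U =>
    (AddCommGrpCat.mono_iff_injective _).2 (discUnit_injective P U.unop)
  have : Mono ((TopCat.Sheaf.forget _ X).map (discUnitSheaf P)) :=
    NatTrans.mono_of_mono_app (discUnit P.obj)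
  exact (TopCat.Sheaf.forget _ X).mono_of_mono_map this

/-- The Godement complex of an injective sheaf is exact in positive degrees. -/
lemma godementOn_exact_of_injective (I : TopCat.Sheaf AddCommGrpCat.{w} X) [Injective I] (q : ℕ)
    (x : ((godementOn X).obj I.obj).X (q + 1))
    (hx : ((godementOn X).obj I.obj).d (q + 1) (q + 2) x = 0) :
    ∃ y, ((godementOn X).obj I.obj).d q (q + 1) y = x := by
  refine godementOn_exact_of_retract (Injective.factorThru (𝟙 I) (discUnitSheaf I)).hom ?_ q x hx
  exact congrArg (fun k => k.hom) (Injective.comp_factorThru (𝟙 I) (discUnitSheaf I))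

/-- One step of a dimension shift: exactness for the outer terms of a short exact sequence. -/
lemma LocallyExact.exists_d_eq {P Q R : X.Presheaf AddCommGrpCat.{w}} {f : P ⟶ Q} {g : Q ⟶ R}
    (h : LocallyExact f g) {q : ℕ}
    (hQ : ∀ x : ((godementOn X).obj Q).X (q + 1), ((godementOn X).obj Q).d (q + 1) (q + 2) x = 0 →
      ∃ y, ((godementOn X).obj Q).d q (q + 1) y = x)
    (hR : ∀ z : ((godementOn X).obj R).X q, ((godementOn X).obj R).d q (q + 1) z = 0 →
      ∃ c, ((godementOn X).obj Q).d q (q + 1) c = 0 ∧ ((godementOn X).map g).f q c = z)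
    (x : ((godementOn X).obj P).X (q + 1))
    (hx : ((godementOn X).obj P).d (q + 1) (q + 2) x = 0) :
    ∃ y, ((godementOn X).obj P).d q (q + 1) y = x := by
  have comm : ∀ {A B : X.Presheaf AddCommGrpCat.{w}} (k : A ⟶ B) (i j) (a),
      ((godementOn X).obj B).d i j (((godementOn X).map k).f i a) =
        ((godementOn X).map k).f j (((godementOn X).obj A).d i j a) := fun k i j a =>
    ConcreteCategory.congr_hom (((godementOn X).map k).comm i j) a
  obtain ⟨z, hz⟩ := hQ (((godementOn X).map f).f (q + 1) x) (by
    rw [comm, hx]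
    exact map_zero (((godementOn X).map f).f (q + 2)).hom)
  obtain ⟨c, hc, hcz⟩ := hR (((godementOn X).map g).f q z) (by
    rw [comm, hz]
    exact (h.godement_exact (q + 1) _).2 ⟨x, rfl⟩)
  obtain ⟨y, hy⟩ := (h.godement_exact q (z - c)).1 (by rw [map_sub, hcz, sub_self])
  refine ⟨y, h.godement_injective (q + 1) ?_⟩
  rw [← comm, hy, map_sub, hc, hz, sub_zero]

/-- The Godement complex of a flasque sheaf is exact in positive degrees, by dimension shifting
along `0 ⟶ P ⟶ C⁰(P) ⟶ Q ⟶ 0`. -/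
lemma godementOn_exact_of_isFlasque (q : ℕ) : ∀ (P : TopCat.Sheaf AddCommGrpCat.{w} X) [P.IsFlasque]
    (x : ((godementOn X).obj P.obj).X (q + 1)),
    ((godementOn X).obj P.obj).d (q + 1) (q + 2) x = 0 →
      ∃ y, ((godementOn X).obj P.obj).d q (q + 1) y = x := by
  induction q with
  | zero =>
    intro P _
    let S : ShortComplex (TopCat.Sheaf AddCommGrpCat.{w} X) :=
      ShortComplex.mk (discUnitSheaf P) _ (cokernel.condition _)
    have hS : S.ShortExact :=
      { exact := ShortComplex.exact_cokernel _
        mono_f := inferInstanceAs (Mono (discUnitSheaf P))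
        epi_g := inferInstanceAs (Epi (cokernel.π (discUnitSheaf P))) }
    have h := locallyExact_of_shortExact hS
    refine h.exists_d_eq (godementOn_disc_exact P.obj 0) fun z hz => ?_
    obtain ⟨t, rfl⟩ := (exists_discUnit_eq S.X₃ z).1 hz
    have : S.X₁.IsFlasque := ‹P.IsFlasque›
    obtain ⟨s, rfl⟩ := (AddCommGrpCat.epi_iff_surjective _).1
      (TopCat.Sheaf.IsFlasque.epi_of_shortExact (U := ⊤) hS) t
    refine ⟨(discUnit S.X₂.obj).app (op ⊤) s, (exists_discUnit_eq S.X₂ _).2 ⟨s, rfl⟩, ?_⟩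
    exact godementOn_map_discUnit S.g.hom s
  | succ q ih =>
    intro P _
    let S : ShortComplex (TopCat.Sheaf AddCommGrpCat.{w} X) :=
      ShortComplex.mk (discUnitSheaf P) _ (cokernel.condition _)
    have hS : S.ShortExact :=
      { exact := ShortComplex.exact_cokernel _
        mono_f := inferInstanceAs (Mono (discUnitSheaf P))
        epi_g := inferInstanceAs (Epi (cokernel.π (discUnitSheaf P))) }
    have h := locallyExact_of_shortExact hS
    have h₁ : S.X₁.IsFlasque := ‹P.IsFlasque›
    have h₂ : S.X₂.IsFlasque := inferInstanceAs (discSheaf P.obj).IsFlasque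
    have h₃ : S.X₃.IsFlasque := TopCat.Sheaf.IsFlasque.of_shortExact_of_isFlasque₁₂ hS
    refine h.exists_d_eq (godementOn_disc_exact P.obj (q + 1)) fun z hz => ?_
    obtain ⟨v, rfl⟩ := ih S.X₃ z hz
    obtain ⟨v', rfl⟩ := h.godement_surjective q v
    exact ⟨((godementOn X).obj S.X₂.obj).d q (q + 1) v', Filtration.d_d _ _ _ _,
      (ConcreteCategory.congr_hom (((godementOn X).map S.g.hom).comm q (q + 1)) v').symm⟩

end Acyclic

/-! ### The Godement resolution computes sheaf cohomology -/

section TopologicalCohomology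

lemma nonempty_functorH_zero_iso {C : Type*} [Category* C] (J : GrothendieckTopology C)
    [HasSheafify J AddCommGrpCat.{w}] [HasExt.{w} (Sheaf J AddCommGrpCat.{w})] {T : C}
    (hT : IsTerminal T) :
    Nonempty (Sheaf.functorH.{w, w} J 0 ≅
      sheafToPresheaf J AddCommGrpCat.{w} ⋙ (evaluation _ _).obj (op T)) :=
  ⟨NatIso.ofComponents (fun F => (Sheaf.H.equiv₀ F hT).toAddCommGrpIso) (fun {F F'} f => by
    ext x
    exact (Sheaf.H.equiv₀_naturality hT f x).symm)⟩

variable (X : TopCat.{w})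

/-- The Godement complex of abelian sheaves on `X`. -/
abbrev godementSheaf : Sheaf (Opens.grothendieckTopology X) AddCommGrpCat.{w} ⥤
    CochainComplex AddCommGrpCat.{w} ℕ :=
  sheafToPresheaf _ _ ⋙ godementOn X

instance : (godementSheaf X).PreservesZeroMorphisms where
  map_zero P Q := by
    ext q x
    exact godementOn_map_zero _ (fun _ _ => rfl) q x

lemma godementSheaf_shortExact
    {S : ShortComplex (Sheaf (Opens.grothendieckTopology X) AddCommGrpCat.{w})}
    (hS : S.ShortExact) : (S.map (godementSheaf X)).ShortExact := by
  have h : LocallyExact S.f.hom S.g.hom := locallyExact_of_shortExact hS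
  refine HomologicalComplex.shortExact_of_degreewise_shortExact _ fun q => ?_
  refine ShortComplex.ShortExact.mk' ?_ ?_ ?_
  · exact (ShortComplex.ab_exact_iff _).2 fun x hx => (h.godement_exact q x).1 hx
  · exact (AddCommGrpCat.mono_iff_injective _).2 (h.godement_injective q)
  · exact (AddCommGrpCat.epi_iff_surjective _).2 (h.godement_surjective q)

/-- The Godement resolution computes sheaf cohomology. -/
theorem nonempty_functorH_iso_godementSheaf (q : ℕ) :
    Nonempty (Sheaf.functorH.{w, w} (Opens.grothendieckTopology X) q ≅
      godementSheaf X ⋙ HomologicalComplex.homologyFunctor _ _ q) := by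
  refine DeltaFunctor.nonempty_iso (deltaSheafH _)
    (deltaOfExact (godementSheaf X) (fun S hS => godementSheaf_shortExact X hS)
      fun I _ n => ?_) ?_ q
  · refine isZero_homology_of_exact _ _ fun x hx => ⟨n, ?_⟩
    exact @godementOn_exact_of_injective X I ‹_› n x (hx _)
  · refine (nonempty_functorH_zero_iso _ (isTerminalTop (α := Opens X))).some ≪≫
      (nonempty_iso_homology_zero (godementSheaf X)
        (Γ := sheafToPresheaf _ _ ⋙ (evaluation _ _).obj (op ⊤))
        (fun P => (discUnit P.obj).app (op ⊤)) ?_ ?_ ?_ ?_).some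
    · intro P Q f
      ext s
      exact (godementOn_map_discUnit f.hom s).symm
    · exact fun P => discUnit_injective P ⊤
    · exact fun P x => (exists_discUnit_eq P _).2 ⟨x, rfl⟩
    · exact fun P y hy => (exists_discUnit_eq P y).1 hy

end TopologicalCohomology

/-! ### Exactness of the double complex -/

section DoubleComplexExact

variable {G : Type u} [Group G] [TopologicalSpace G] [IsTopologicalGroup G]

lemma sections_injective {C : Type*} [Category* C] (J : GrothendieckTopology C)
    [HasSheafify J AddCommGrpCat.{w}]
    {S : ShortComplex (Sheaf J AddCommGrpCat.{w})} (hS : S.ShortExact) (Y : C) :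
    Function.Injective (S.f.hom.app (op Y)) := by
  have := hS.mono_f
  exact (AddCommGrpCat.mono_iff_injective _).1 (inferInstanceAs
    (Mono ((sheafToPresheaf J AddCommGrpCat.{w} ⋙ (evaluation _ _).obj (op Y)).map S.f)))

lemma sections_exact {C : Type*} [Category* C] (J : GrothendieckTopology C)
    [HasSheafify J AddCommGrpCat.{w}]
    {S : ShortComplex (Sheaf J AddCommGrpCat.{w})} (hS : S.ShortExact) (Y : C)
    (s : S.X₂.obj.obj (op Y)) : S.g.hom.app (op Y) s = 0 ↔ ∃ t, S.f.hom.app (op Y) t = s := by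
  constructor
  · intro h
    have := hS.mono_f
    exact (ShortComplex.ab_exact_iff _).1 (hS.exact.map_of_mono_of_preservesKernel
      (sheafToPresheaf J AddCommGrpCat.{w} ⋙ (evaluation _ _).obj (op Y)) hS.mono_f
        inferInstance) s h
  · rintro ⟨t, rfl⟩
    exact congrArg (fun k => k.hom.app (op Y) t) S.zero

lemma locallyExact_restrict {S : ShortComplex (Sheaf (topology G) AddCommGrpCat.{u + 1})}
    (hS : S.ShortExact) (T : Type u) [TopologicalSpace T] :
    LocallyExact ((restrict G T).map S.f).hom ((restrict G T).map S.g).hom where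
  injective U := sections_injective _ hS (free G (sub U))
  exact U s := sections_exact _ hS (free G (sub U)) s
  surjective U s x hx := by
    have : Sheaf.IsLocallySurjective S.g := 
      (Sheaf.isLocallySurjective_iff_epi' AddCommGrpCat.{u + 1} S.g).2 hS.epi_g
    obtain ⟨V, hV, Y, f, ⟨t, ht⟩, σ, hσ⟩ :=
      Presheaf.imageSieve_mem (topology G) S.g.hom (U := op (free G (sub U))) s
        (show free G (sub U) from ((1, ⟨x.down, hx⟩) : G × sub U))
    -- The section `σ`, restricted to `{1} × T`, extends to an equivariant section.
    let W : Opens (big T) := ⟨{y | ∃ h : y ∈ U, ((1, ⟨y.down, h⟩) : G × sub U) ∈ V}, by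
      let j : U → free G (sub U) := fun y => ((1, ⟨y.1.down, y.2⟩) : G × sub U)
      have hj : Continuous j := by
        change Continuous fun y : U => ((1, ⟨y.1.down, y.2⟩) : G × sub U)
        fun_prop
      have := U.isOpen.isOpenMap_subtype_val _ (V.isOpen.preimage hj)
      convert this using 1
      ext y
      exact ⟨fun ⟨h, hv⟩ => ⟨⟨y, h⟩, hv, rfl⟩, by rintro ⟨⟨y, h⟩, hv, rfl⟩; exact ⟨h, hv⟩⟩⟩
    let k : C(sub W, Y) := ⟨fun y => σ ⟨((1, ⟨y.1, y.2.1⟩) : G × sub U), y.2.2⟩, by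
      refine σ.continuous.comp (Continuous.subtype_mk ?_ _)
      change Continuous fun y : sub W => ((1, ⟨y.1, y.2.1⟩) : G × sub U)
      fun_prop⟩
    have hW : W ≤ U := fun y hy => hy.1
    have hk : freeDesc k ≫ f = freeIncl hW := by
      refine GSpace.hom_ext fun p => ?_
      change GSpace.fn f (p.1 • k p.2) = ((p.1, ⟨p.2.1, hW p.2.2⟩) : G × sub U)
      rw [GSpace.fn_smul]
      refine (congrArg (p.1 • ·) (hσ _)).trans ?_
      exact Prod.ext (mul_one p.1) rfl
    refine ⟨W, hW, ⟨hx, hV⟩, S.X₂.obj.map (freeDesc k).op t, ?_⟩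
    refine (ConcreteCategory.congr_hom (S.g.hom.naturality (freeDesc k).op) t).trans ?_
    refine (congrArg (S.X₃.obj.map (freeDesc k).op) ht).trans ?_
    refine (ConcreteCategory.congr_hom (S.X₃.obj.map_comp f.op (freeDesc k).op) s).symm.trans ?_
    rw [← op_comp, hk]
    rfl

instance : (doubleComplex G).PreservesZeroMorphisms where
  map_zero F F' := by
    ext p q x
    exact godementOn_map_zero (X := big (Fin p → G)) _ (fun _ _ => rfl) q x

lemma totalComplex_shortExact {S : ShortComplex (Sheaf (topology G) AddCommGrpCat.{u + 1})}
    (hS : S.ShortExact) :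
    (S.map (doubleComplex G ⋙ HomologicalComplex₂.totalFunctor _ _ _
      (ComplexShape.up ℕ))).ShortExact := by
  have h := fun p : ℕ => locallyExact_restrict hS (Fin p → G)
  exact total_shortExact (S.map (doubleComplex G)) (fun p q => (h p).godement_injective q)
    (fun p q x hx => ((h p).godement_exact q x).1 hx) (fun p q => (h p).godement_surjective q)

variable (G) in
/-- The columns of the double complex compute the cohomology of the sheaves `F_p` on `G^p`. -/
lemma nonempty_powerH_iso_columnH (p q : ℕ) : Nonempty (powerH G p q ≅ columnH G p q) :=
  ⟨Functor.isoWhiskerLeft (restrict G (Fin p → G))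
    (nonempty_functorH_iso_godementSheaf (big (Fin p → G)) q).some⟩

end DoubleComplexExact

/-! ### The rows of the double complex -/

section Rows

variable {G : Type u} [Group G] [TopologicalSpace G] [IsTopologicalGroup G]

variable (G) in
/-- The `G`-space `G × G^p`. -/
abbrev barSpace (p : ℕ) : GSpace G := free G (sub (⊤ : Opens (big (Fin p → G))))

/-- The `G`-maps `G × G^(p+1) ⟶ G × G^p`. -/
def barFace (p : ℕ) (i : Fin (p + 2)) : barSpace G (p + 1) ⟶ barSpace G p :=
  Twist.freeMapOn ((bar G).δ i).unop ⊤

/-- The alternating sum of the maps `F (G × G^p) ⟶ F (G × G^(p+1))`. -/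
def barD (F : (GSpace G)ᵒᵖ ⥤ AddCommGrpCat.{u + 1}) (p : ℕ) :
    F.obj (op (barSpace G p)) ⟶ F.obj (op (barSpace G (p + 1))) :=
  ∑ i : Fin (p + 2), (-1 : ℤ) ^ (i : ℕ) • F.map (barFace p i).op

lemma barD_apply (F : (GSpace G)ᵒᵖ ⥤ AddCommGrpCat.{u + 1}) (p : ℕ)
    (s : F.obj (op (barSpace G p))) :
    barD F p s = ∑ i : Fin (p + 2), (-1 : ℤ) ^ (i : ℕ) • F.map (barFace p i).op s :=
  sum_zsmul_apply _ _ s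

lemma barD_naturality {F F' : (GSpace G)ᵒᵖ ⥤ AddCommGrpCat.{u + 1}} (f : F ⟶ F') (p : ℕ)
    (s : F.obj (op (barSpace G p))) : barD F' p (f.app _ s) = f.app _ (barD F p s) := by
  rw [barD_apply, barD_apply, map_sum]
  refine Finset.sum_congr rfl fun i _ => ?_
  rw [map_zsmul]
  exact congrArg _ (ConcreteCategory.congr_hom (f.naturality (barFace p i).op) s).symm

variable (F : Sheaf (topology G) AddCommGrpCat.{u + 1})

/-- The embedding of `F (G × G^p)` in the `p`-th column. -/
def rowUnit (p : ℕ) :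
    F.obj.obj (op (barSpace G p)) ⟶ (((doubleComplex G).obj F).X p).X 0 :=
  (discUnit ((restrict G (Fin p → G)).obj F).obj).app (op ⊤)

lemma rowUnit_injective (p : ℕ) : Function.Injective (rowUnit F p) :=
  discUnit_injective ((restrict G (Fin p → G)).obj F) ⊤

lemma exists_rowUnit_eq (p : ℕ) (x : (((doubleComplex G).obj F).X p).X 0) :
    (((doubleComplex G).obj F).X p).d 0 1 x = 0 ↔ ∃ s, rowUnit F p s = x :=
  exists_discUnit_eq ((restrict G (Fin p → G)).obj F) x

lemma rowUnit_naturality {F F' : Sheaf (topology G) AddCommGrpCat.{u + 1}} (f : F ⟶ F') (p : ℕ)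
    (s : F.obj.obj (op (barSpace G p))) :
    (((doubleComplex G).map f).f p).f 0 (rowUnit F p s) = rowUnit F' p (f.hom.app _ s) :=
  godementOn_map_discUnit ((restrict G (Fin p → G)).map f).hom s

lemma sum_zsmul_f_apply {K L : CochainComplex AddCommGrpCat.{w} ℕ} {n : ℕ} (c : Fin n → ℤ)
    (f : Fin n → (K ⟶ L)) (k : ℕ) (x : K.X k) :
    (∑ i, c i • f i).f k x = ∑ i, c i • (f i).f k x := by
  have h : (∑ i, c i • f i).f k = ∑ i, c i • (f i).f k := by
    change (HomologicalComplex.eval _ _ k).map (∑ i, c i • f i) = _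
    rw [Functor.map_sum]
    rfl
  rw [h, sum_zsmul_apply]

/-- The horizontal differential restricts to the alternating sum of the maps induced by the
faces. -/
lemma d_rowUnit (p : ℕ) (s : F.obj.obj (op (barSpace G p))) :
    (((doubleComplex G).obj F).d p (p + 1)).f 0 (rowUnit F p s) =
      rowUnit F (p + 1) (barD F.obj p s) := by
  let D := ((bar G).map pairFunctor).map
    ((Functor.whiskeringRight _ _ _).obj godementComplex.{u + 1})
  refine (congrArg (fun k => k.f 0 (rowUnit F p s)) (D.asFunctor_d F p)).trans ?_
  refine (sum_zsmul_f_apply _ _ _ _).trans ?_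
  rw [barD_apply, map_sum]
  refine Finset.sum_congr rfl fun i _ => ?_
  rw [map_zsmul]
  refine congrArg _ ?_
  let m : pairObj _ F ⟶ pairObj _ F := pairMap ((bar G).δ (n := p) i).unop F
  exact congrArg (fun k => globalMap k s) (godementUnit.naturality m)

end Rows

/-! ### Injective sheaves -/

section Injectives

variable {C : Type (u + 1)} [Category.{u} C]

/-- The presheaf `Y ↦ ∏_{Z ⟶ Y} I(Z)`. -/
def productPresheaf (I : Cᵒᵖ ⥤ AddCommGrpCat.{u + 1}) : Cᵒᵖ ⥤ AddCommGrpCat.{u + 1} where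
  obj Y := AddCommGrpCat.of (∀ (Z : C) (_ : Z ⟶ Y.unop), I.obj (op Z))
  map g := AddCommGrpCat.ofHom
    { toFun s Z f := s Z (f ≫ g.unop)
      map_zero' := rfl
      map_add' _ _ := rfl }
  map_id Y := by
    ext s Z f
    exact congrArg (s Z) (Category.comp_id f)
  map_comp g g' := by
    ext s Z f
    exact congrArg (s Z) (Category.assoc f _ _).symm

/-- The embedding of `I` in `Y ↦ ∏_{Z ⟶ Y} I(Z)`. -/
def productUnit (I : Cᵒᵖ ⥤ AddCommGrpCat.{u + 1}) : I ⟶ productPresheaf I where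
  app Y := AddCommGrpCat.ofHom
    { toFun s Z f := I.map f.op s
      map_zero' := funext fun Z => funext fun f => map_zero (I.map f.op).hom
      map_add' s t := funext fun Z => funext fun f => map_add (I.map f.op).hom s t }
  naturality Y Y' g := by
    ext s
    funext Z f
    exact (ConcreteCategory.congr_hom (I.map_comp g f.op) s).symm

lemma productUnit_injective (I : Cᵒᵖ ⥤ AddCommGrpCat.{u + 1}) (Y : Cᵒᵖ) :
    Function.Injective ((productUnit I).app Y) := fun s t h => by
  have h' := congrFun (congrFun h Y.unop) (𝟙 _)
  exact (ConcreteCategory.congr_hom (I.map_id Y) s).symm.trans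
    (h'.trans (ConcreteCategory.congr_hom (I.map_id Y) t))

variable (J : GrothendieckTopology C) [HasSheafify J AddCommGrpCat.{u + 1}]
  (I : Sheaf J AddCommGrpCat.{u + 1}) [Injective I]

lemma exists_productUnit_retract :
    ∃ r : productPresheaf I.obj ⟶ I.obj, productUnit I.obj ≫ r = 𝟙 _ := by
  have : Injective ((sheafToPresheaf J AddCommGrpCat.{u + 1}).obj I) :=
    Injective.injective_of_adjoint (sheafificationAdjunction J AddCommGrpCat.{u + 1}) I
  have : Injective I.obj := this
  have : ∀ Y, Mono ((productUnit I.obj).app Y) := fun Y =>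
    (AddCommGrpCat.mono_iff_injective _).2 (productUnit_injective I.obj Y)
  have : Mono (productUnit I.obj) := NatTrans.mono_of_mono_app _
  exact ⟨Injective.factorThru (𝟙 _) (productUnit I.obj), Injective.comp_factorThru _ _⟩

/-- Sections of an injective sheaf extend along monomorphisms. -/
lemma map_surjective_of_injective {Y Y' : C} (m : Y ⟶ Y') [Mono m] :
    Function.Surjective (I.obj.map m.op) := by
  classical
  intro s
  obtain ⟨r, hr⟩ := exists_productUnit_retract J I
  let t : (productPresheaf I.obj).obj (op Y') := fun Z f' =>
    if h : ∃ f : Z ⟶ Y, f ≫ m = f' then I.obj.map h.choose.op s else 0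
  have ht : (productPresheaf I.obj).map m.op t = (productUnit I.obj).app (op Y) s := by
    funext Z f
    have h : ∃ f₀ : Z ⟶ Y, f₀ ≫ m = f ≫ m := ⟨f, rfl⟩
    refine (dif_pos h).trans ?_
    rw [(cancel_mono m).1 h.choose_spec]
    rfl
  refine ⟨r.app _ t, ?_⟩
  refine (ConcreteCategory.congr_hom (r.naturality m.op) t).symm.trans ?_
  refine (congrArg (r.app (op Y)) ht).trans ?_
  exact congrArg (fun k => k.app (op Y) s) hr

end Injectives

section InjectiveRows

variable {G : Type u} [Group G] [TopologicalSpace G] [IsTopologicalGroup G]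

instance {T : Type u} [TopologicalSpace T] {V U : Opens (big T)} (h : V ≤ U) :
    Mono (freeIncl (G := G) h) where
  right_cancellation {Z} a b hab := GSpace.hom_ext fun z => by
    have h₁ := congrArg (fun k : Z ⟶ free G (sub U) => (GSpace.fn k z).1) hab
    have h₂ := congrArg (fun k : Z ⟶ free G (sub U) => ((GSpace.fn k z).2 : sub U).1) hab
    exact Prod.ext h₁ (Subtype.ext h₂)

lemma isFlasque_restrict (I : Sheaf (topology G) AddCommGrpCat.{u + 1}) [Injective I] (T : Type u)
    [TopologicalSpace T] : TopCat.Sheaf.IsFlasque (X := big T) ((restrict G T).obj I) where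
  epi i := (AddCommGrpCat.epi_iff_surjective _).2
    (map_surjective_of_injective (topology G) I (freeIncl i.unop.le))

lemma faceBase_cons {p : ℕ} (i : Fin (p + 2)) (a : G) (t : Fin (p + 1) → G) :
    faceBase i.succ (Fin.cons a t : Fin (p + 2) → G) =
      Fin.cons (a * faceShift i t) (faceBase i t) := by
  funext k
  rw [faceBase_succ]
  induction i using Fin.cases with
  | zero =>
    rw [faceBase_zero]
    induction k using Fin.cases with
    | zero => simp [faceShift, Fin.contractNth]
    | succ k => simp [Fin.contractNth, Fin.tail]
  | succ i =>
    rw [faceBase_succ]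
    induction k using Fin.cases with
    | zero => simp [faceShift, Fin.contractNth, Fin.succ_ne_zero]
    | succ k => simp [Fin.contractNth]

/-- The map `Z ⟶ G × G^(p+1)`, `z ↦ (e z, (e z)⁻¹ * g₀, g₁, …, g_p)` with
`f z = (g₀, …, g_p)`, attached to equivariant maps `e : Z ⟶ G` and `f : Z ⟶ G × G^p`. -/
def insertVertex {Z : GSpace G} (e : Z ⟶ free G PUnit.{u + 1}) {p : ℕ} (f : Z ⟶ barSpace G p) :
    Z ⟶ barSpace G (p + 1) where
  toFun z := ((GSpace.fn e z).1, ⟨Fin.cons ((GSpace.fn e z).1⁻¹ * (GSpace.fn f z).1)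
    (GSpace.fn f z).2.1, trivial⟩)
  continuous_toFun := by
    have he : Continuous fun z : Z => (GSpace.fn e z).1 :=
      continuous_fst.comp (GSpace.continuous_fn e)
    have hf : Continuous fun z : Z => (GSpace.fn f z).1 :=
      continuous_fst.comp (GSpace.continuous_fn f)
    have hf' : Continuous fun z : Z => (GSpace.fn f z).2.1 :=
      continuous_subtype_val.comp (continuous_snd.comp (GSpace.continuous_fn f))
    refine he.prodMk (Continuous.subtype_mk (continuous_pi fun k => ?_) _)
    refine Fin.cases ?_ (fun k => ?_) k
    · exact he.inv.mul hf
    · exact (continuous_apply k).comp hf'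
  map_smul' g z := by
    have he : (GSpace.fn e (g • z)).1 = g * (GSpace.fn e z).1 :=
      congrArg Prod.fst (GSpace.fn_smul e g z)
    have hf : GSpace.fn f (g • z) = g • GSpace.fn f z := GSpace.fn_smul f g z
    have hf₁ : (GSpace.fn f (g • z)).1 = g * (GSpace.fn f z).1 := congrArg Prod.fst hf
    have hf₂ : (GSpace.fn f (g • z)).2.1 = (GSpace.fn f z).2.1 := by
      have := congrArg (fun y : barSpace G p => y.2.1) hf
      exact this
    refine Prod.ext he (Subtype.ext ?_)
    change (Fin.cons ((GSpace.fn e (g • z)).1⁻¹ * (GSpace.fn f (g • z)).1)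
        (GSpace.fn f (g • z)).2.1 : Fin (p + 1) → G) =
      Fin.cons ((GSpace.fn e z).1⁻¹ * (GSpace.fn f z).1) (GSpace.fn f z).2.1
    rw [he, hf₁, hf₂, mul_inv_rev, mul_assoc, inv_mul_cancel_left]

lemma insertVertex_zero {Z : GSpace G} (e : Z ⟶ free G PUnit.{u + 1}) {p : ℕ}
    (f : Z ⟶ barSpace G p) : insertVertex e f ≫ barFace p 0 = f :=
  GSpace.hom_ext fun _ => Prod.ext (mul_inv_cancel_left _ _) (Subtype.ext rfl)

lemma insertVertex_succ {Z : GSpace G} (e : Z ⟶ free G PUnit.{u + 1}) {p : ℕ}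
    (f : Z ⟶ barSpace G (p + 1)) (i : Fin (p + 2)) :
    insertVertex e f ≫ barFace (p + 1) i.succ = insertVertex e (f ≫ barFace p i) := by
  refine GSpace.hom_ext fun z => Prod.ext (mul_one _) (Subtype.ext ?_)
  refine (faceBase_cons i _ _).trans ?_
  rw [mul_assoc]
  rfl

/-- For an injective sheaf `I`, the complex `I (G × G^•)` is exact in positive degrees. -/
lemma exists_barD_eq (I : Sheaf (topology G) AddCommGrpCat.{u + 1}) [Injective I] (p : ℕ)
    (s : I.obj.obj (op (barSpace G (p + 1)))) (hs : barD I.obj (p + 1) s = 0) :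
    ∃ t, barD I.obj p t = s := by
  classical
  obtain ⟨r, hr⟩ := exists_productUnit_retract (topology G) I
  -- The inserted vertex may depend on `Z`, but not on `f`; it exists as soon as there is some `f`.
  let t : (productPresheaf I.obj).obj (op (barSpace G p)) := fun Z f =>
    if h : Nonempty (Z ⟶ free G PUnit.{u + 1}) then
      I.obj.map (insertVertex h.some f).op s else 0
  have ht : barD (productPresheaf I.obj) p t = (productUnit I.obj).app _ s := by
    funext Z f
    have h : Nonempty (Z ⟶ free G PUnit.{u + 1}) := ⟨f ≫ freeMap (.const _ PUnit.unit) 1⟩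
    have ht' : ∀ f' : Z ⟶ barSpace G p, t Z f' = I.obj.map (insertVertex h.some f').op s :=
      fun f' => dif_pos h
    have h₁ : barD (productPresheaf I.obj) p t Z f =
        ∑ i : Fin (p + 2), (-1 : ℤ) ^ (i : ℕ) • t Z (f ≫ barFace p i) := by
      rw [barD_apply]
      refine (congrFun (Finset.sum_apply Z Finset.univ _) f).trans ?_
      exact Finset.sum_apply f Finset.univ _
    -- Pull back `hs` along `insertVertex h.some f`.
    have h₂ := congrArg (I.obj.map (insertVertex h.some f).op) hs
    have h₃ : ∀ i, I.obj.map (insertVertex h.some f).op (I.obj.map (barFace (p + 1) i).op s) =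
        I.obj.map (insertVertex h.some f ≫ barFace (p + 1) i).op s := fun i =>
      (ConcreteCategory.congr_hom (I.obj.map_comp _ _) s).symm
    rw [barD_apply, map_sum, map_zero (I.obj.map _).hom, Fin.sum_univ_succ, map_zsmul, h₃,
      insertVertex_zero, Fin.val_zero, pow_zero, one_smul, add_eq_zero_iff_eq_neg'] at h₂
    refine h₁.trans (Eq.trans ?_ (neg_eq_iff_eq_neg.2 h₂))
    rw [← Finset.sum_neg_distrib]
    refine Finset.sum_congr rfl fun i _ => ?_
    rw [map_zsmul, h₃, insertVertex_succ, ht', Fin.val_succ, pow_succ, mul_neg_one,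
      neg_smul, neg_neg]
  refine ⟨r.app _ t, (barD_naturality r p t).trans ?_⟩
  rw [ht]
  exact congrArg (fun k => k.app _ s) hr

/-- For an injective sheaf, the total complex is exact in positive degrees. -/
lemma isZero_total_of_injective (I : Sheaf (topology G) AddCommGrpCat.{u + 1}) [Injective I]
    (n : ℕ) : IsZero ((tot ((doubleComplex G).obj I)).homology (n + 1)) := by
  refine isZero_homology_tot _ (fun p q x hx => ?_) (fun p x hx hx' => ?_) n
  · have := isFlasque_restrict I (Fin p → G)
    exact godementOn_exact_of_isFlasque (X := big (Fin p → G)) q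
      ((restrict G (Fin p → G)).obj I) x hx
  · obtain ⟨s, rfl⟩ := (exists_rowUnit_eq I (p + 1) x).1 hx
    rw [d_rowUnit] at hx'
    obtain ⟨t, rfl⟩ := exists_barD_eq I p s
      (rowUnit_injective I (p + 2) (hx'.trans (map_zero (rowUnit I (p + 2)).hom).symm))
    exact ⟨rowUnit I p t, (exists_rowUnit_eq I p _).2 ⟨t, rfl⟩, d_rowUnit I p t⟩

end InjectiveRows

/-! ### Hypercohomology -/

section Hypercohomology

variable {G : Type u} [Group G] [TopologicalSpace G] [IsTopologicalGroup G]

variable (G) in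
/-- The `G`-map `G × G^0 ⟶ *`, a covering in `T_G`. -/
abbrev barAugmentation : barSpace G 0 ⟶ point G := (pointIsTerminal G).from _

lemma barFace_augmentation (i : Fin 2) :
    barFace 0 i ≫ barAugmentation G = barFace 0 0 ≫ barAugmentation G :=
  (pointIsTerminal G).hom_ext _ _

lemma insertVertex_one {Z : GSpace G} (a b : Z ⟶ barSpace G 0) :
    insertVertex (a ≫ freeMap (.const _ PUnit.unit) 1) b ≫ barFace 0 1 = a := by
  refine GSpace.hom_ext fun z => Prod.ext ?_ (Subtype.ext (Subsingleton.elim _ _))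
  change (GSpace.fn a z).1 * 1 * 1 = _
  rw [mul_one, mul_one]

variable (F : Sheaf (topology G) AddCommGrpCat.{u + 1})

/-- The sheaf condition for the covering `G × G^0 ⟶ *`. -/
lemma existsUnique_augmentation (s : F.obj.obj (op (barSpace G 0))) (hs : barD F.obj 0 s = 0) :
    ∃! x, F.obj.map (barAugmentation G).op x = s := by
  have hs' : F.obj.map (barFace 0 0).op s = F.obj.map (barFace 0 1).op s := by
    rw [barD_apply, Fin.sum_univ_two, Fin.val_zero, Fin.val_one, pow_zero, pow_one, one_smul,
      neg_one_zsmul, add_neg_eq_zero] at hs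
    exact hs
  have hF : Presieve.IsSheaf (topology G) (F.obj ⋙ forget AddCommGrpCat.{u + 1}) :=
    (isSheaf_iff_isSheaf_of_type _ _).1
      ((Presheaf.isSheaf_iff_isSheaf_forget _ _ (forget AddCommGrpCat.{u + 1})).1 F.property)
  have hcov : Sieve.generate (Presieve.singleton (barAugmentation G)) ∈ topology G (point G) :=
    fun x => ⟨⊤, trivial, _, _, Sieve.le_generate _ _ _ (Presieve.singleton_self _),
      .const _ ((1, ⟨Fin.elim0, trivial⟩) : G × sub (⊤ : Opens (big (Fin 0 → G)))), fun _ => rfl⟩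
  refine Presieve.isSheafFor_singleton.1 ((Presieve.isSheafFor_iff_generate _).2 (hF _ hcov)) s
    fun {Z} a b _ => ?_
  -- `(a, b)` factors through `G × G^1`, whose two faces are `b` and `a`.
  let c := insertVertex (a ≫ freeMap (.const _ PUnit.unit) 1) b
  have ha : c ≫ barFace 0 1 = a := insertVertex_one a b
  have hb : c ≫ barFace 0 0 = b := insertVertex_zero _ b
  have h := congrArg (F.obj.map c.op) hs'
  have key : ∀ i, F.obj.map c.op (F.obj.map (barFace 0 i).op s) =
      F.obj.map (c ≫ barFace 0 i).op s := fun i =>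
    (ConcreteCategory.congr_hom (F.obj.map_comp _ _) s).symm
  rw [key, key, ha, hb] at h
  exact h.symm

lemma barD_augmentation (x : F.obj.obj (op (point G))) :
    barD F.obj 0 (F.obj.map (barAugmentation G).op x) = 0 := by
  have key : ∀ i, F.obj.map (barFace 0 i).op (F.obj.map (barAugmentation G).op x) =
      F.obj.map (barFace 0 0 ≫ barAugmentation G).op x := fun i => by
    rw [← barFace_augmentation i]
    exact (ConcreteCategory.congr_hom (F.obj.map_comp _ _) x).symm
  rw [barD_apply, Fin.sum_univ_two, key, key, Fin.val_zero, Fin.val_one, pow_zero, pow_one,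
    one_smul, neg_one_zsmul, add_neg_cancel]

lemma augmentation_injective : Function.Injective (F.obj.map (barAugmentation G).op) :=
  fun _ y h => (existsUnique_augmentation F _ (barD_augmentation F y)).unique h rfl

lemma tot_d_zero_eq_zero_iff (K : HomologicalComplex₂ AddCommGrpCat.{w} (ComplexShape.up ℕ)
    (ComplexShape.up ℕ)) (y : (tot K).X 0) :
    (tot K).d 0 1 y = 0 ↔
      (K.X 0).d 0 1 (totπ K 0 0 0 y) = 0 ∧ (K.d 0 1).f 0 (totπ K 0 0 0 y) = 0 := by
  have h₁ : totπ K 0 1 1 ((tot K).d 0 1 y) = (K.X 0).d 0 1 (totπ K 0 0 0 y) := by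
    refine (totπ_d K 0 1 0 1 rfl rfl y).trans ?_
    rw [K.shape _ _ (by simp), pow_zero, one_smul]
    exact zero_add _
  have h₂ : totπ K 1 0 1 ((tot K).d 0 1 y) = (K.d 0 1).f 0 (totπ K 0 0 0 y) := by
    refine (totπ_d K 1 0 0 1 rfl rfl y).trans ?_
    rw [col_d_eq_zero K 1 (0 - 1) 0 (by lia), smul_zero, add_zero]
  rw [← h₁, ← h₂]
  refine ⟨fun h => by rw [h, map_zero, map_zero]; exact ⟨rfl, rfl⟩,
    fun h => tot_ext K fun p q hpq => ?_⟩
  rw [map_zero]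
  obtain ⟨rfl, rfl⟩ | ⟨rfl, rfl⟩ : (p = 0 ∧ q = 1) ∨ (p = 1 ∧ q = 0) := by lia
  · exact h.1
  · exact h.2

variable (G) in
/-- In degree zero, both cohomologies are the group of sections over `*`. -/
lemma nonempty_sections_iso_hyperH_zero :
    Nonempty (sheafToPresheaf (topology G) AddCommGrpCat.{u + 1} ⋙
      (evaluation _ _).obj (op (point G)) ≅ hyperH G 0) := by
  have hπ : ∀ (F : Sheaf (topology G) AddCommGrpCat.{u + 1}) (x : F.obj.obj (op (point G))),
      totπ ((doubleComplex G).obj F) 0 0 0 ((F.obj.map (barAugmentation G).op ≫ rowUnit F 0 ≫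
        totι ((doubleComplex G).obj F) 0 0 0 rfl) x) =
      rowUnit F 0 (F.obj.map (barAugmentation G).op x) :=
    fun F x => totπ_totι_apply _ 0 0 0 rfl _
  refine nonempty_iso_homology_zero (doubleComplex G ⋙ HomologicalComplex₂.totalFunctor _ _ _
    (ComplexShape.up ℕ))
    (fun F => F.obj.map (barAugmentation G).op ≫ rowUnit F 0 ≫
      totι ((doubleComplex G).obj F) 0 0 0 rfl) ?_ ?_ ?_ ?_
  · intro F F' f
    ext x
    refine tot_ext _ fun p q hpq => ?_
    refine Eq.trans ?_ (totπ_map ((doubleComplex G).map f) p q 0 _).symm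
    obtain ⟨rfl, rfl⟩ : p = 0 ∧ q = 0 := by lia
    refine (hπ F' _).trans (Eq.trans ?_ (congrArg _ (hπ F x)).symm)
    refine Eq.trans ?_ (rowUnit_naturality f 0 _).symm
    exact congrArg (rowUnit F' 0)
      (ConcreteCategory.congr_hom (f.hom.naturality (barAugmentation G).op) x).symm
  · intro F x y hxy
    have h := congrArg (totπ ((doubleComplex G).obj F) 0 0 0) hxy
    exact augmentation_injective F (rowUnit_injective F 0 ((hπ F x).symm.trans (h.trans (hπ F y))))
  · intro F x
    refine (tot_d_zero_eq_zero_iff ((doubleComplex G).obj F) _).2 ?_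
    refine ⟨(exists_rowUnit_eq F 0 _).2 ⟨_, (hπ F x).symm⟩, ?_⟩
    refine (congrArg ((((doubleComplex G).obj F).d 0 1).f 0) (hπ F x)).trans
      ((d_rowUnit F 0 _).trans ?_)
    rw [barD_augmentation]
    exact map_zero (rowUnit F 1).hom
  · intro F y hy
    obtain ⟨h₁, h₂⟩ := (tot_d_zero_eq_zero_iff ((doubleComplex G).obj F) y).1 hy
    obtain ⟨s, hs⟩ := (exists_rowUnit_eq F 0 _).1 h₁
    rw [← hs, d_rowUnit] at h₂
    obtain ⟨x, hx, -⟩ := existsUnique_augmentation F s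
      (rowUnit_injective F 1 (h₂.trans (map_zero (rowUnit F 1).hom).symm))
    refine ⟨x, tot_ext _ fun p q hpq => ?_⟩
    obtain ⟨rfl, rfl⟩ : p = 0 ∧ q = 0 := by lia
    exact (hπ F x).trans ((congrArg (rowUnit F 0) hx).trans hs)

variable (G) in
/-- The cohomology of the one-point space is the hypercohomology of the double complex. -/
theorem nonempty_siteH_iso_hyperH (n : ℕ) : Nonempty (siteH G n ≅ hyperH G n) := by
  let D : DeltaFunctor (siteH G) := deltaSheafH.{u + 1} (topology G)
  let D' : DeltaFunctor (hyperH G) :=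
    deltaOfExact (doubleComplex G ⋙ HomologicalComplex₂.totalFunctor _ _ _ (ComplexShape.up ℕ))
      (fun _ hS => totalComplex_shortExact hS) (fun I _ n => isZero_total_of_injective I n)
  let e : siteH G 0 ≅ sheafToPresheaf (topology G) AddCommGrpCat.{u + 1} ⋙
      (evaluation _ _).obj (op (point G)) :=
    (nonempty_functorH_zero_iso.{u + 1} (topology G) (pointIsTerminal G)).some
  exact D.nonempty_iso D' (e ≪≫ (nonempty_sections_iso_hyperH_zero G).some) n

end Hypercohomology

end LocalSection

end

theorem proposition2p1 (G : Type u) [Group G] [TopologicalSpace G] [IsTopologicalGroup G] :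
    (∀ n : ℕ, Nonempty (LocalSection.siteH G n ≅ LocalSection.hyperH G n)) ∧
    ∃ e : ∀ p q : ℕ, LocalSection.powerH G p q ≅ LocalSection.columnH G p q,
      ∀ F : Sheaf (LocalSection.topology G) AddCommGrpCat.{u + 1},
        ∃ (E : CohomologicalSpectralSequenceNat AddCommGrpCat.{u + 1} 1)
          (φ : ∀ p q : ℕ, (E.page 1).X (p, q) ≅ (LocalSection.powerH G p q).obj F),
          (∀ p q : ℕ, (E.page 1).d (p, q) (p + 1, q) ≫ (φ (p + 1) q).hom ≫ (e (p + 1) q).hom.app F =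
            (φ p q).hom ≫ (e p q).hom.app F ≫ LocalSection.columnD G F p q) ∧
          LocalSection.Converges E (fun n => (LocalSection.siteH G n).obj F) := by
  refine ⟨LocalSection.nonempty_siteH_iso_hyperH G,
    fun p q => (LocalSection.nonempty_powerH_iso_columnH G p q).some, fun F => ?_⟩
  set e := fun p q => (LocalSection.nonempty_powerH_iso_columnH G p q).some
  let K := (LocalSection.doubleComplex G).obj F
  refine ⟨(LocalSection.columnFiltration K).spectralSequence,
    fun p q => (LocalSection.firstPageIso K p q).symm ≪≫ ((e p q).app F).symm, fun p q => ?_,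
    (LocalSection.columnFiltration K).converges fun n =>
      ((LocalSection.nonempty_siteH_iso_hyperH G n).some.app F).symm⟩
  have hφ : ∀ p q, ((LocalSection.firstPageIso K p q).symm ≪≫ ((e p q).app F).symm).hom ≫
      (e p q).hom.app F = (LocalSection.firstPageIso K p q).inv := fun p q => by
    refine (Category.assoc _ _ _).trans ?_
    refine (congrArg _ ((e p q).inv_hom_id_app F)).trans ?_
    exact Category.comp_id _
  refine (congrArg _ (hφ (p + 1) q)).trans (Eq.trans ?_ (Category.assoc _ _ _))
  refine Eq.trans ?_ (congrArg (· ≫ LocalSection.columnD G F p q) (hφ p q)).symm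
  refine (Iso.comp_inv_eq _).2 (Eq.trans ?_ (Category.assoc _ _ _).symm)
  exact (Iso.eq_inv_comp _).2 (LocalSection.firstPageIso_d K p q)
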